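/- **Conventions.** $k$ is the security parameter; "efficient" and "PPT" mean computable by (probabilistic) Boolean circuits of size polynomial in $k$ (the non-uniform setting, as environments have arbitrary auxiliary input); $\approx_c$ is computational indistinguishability by such algorithms. The number $n=n(k)$ of records and the dimension $d=d(k)$ are polynomially bounded. **Ingredients.** (a) An additive homomorphic public-key encryption (AHE) scheme, with efficient algorithms and perfect correctness, whose plaintexts are the residues modulo a number $q<2^{B(k)}$ that may depend on the public key $pk$. It has a homomorphic addition $f$ with $f(E(\alpha),E(\beta))=E(\alpha+\beta)$: the sum of an encryption of $\alpha$ and an encryption of $\beta$ is an encryption of $\alpha+\beta$, and if the encryption of $\beta$ is fresh it is distributed like a fresh encryption of $\alpha+\beta$, up to a negligible statistical error. (b) An efficient number generator $\mathcal G$ which, for a modulus $q$, expands a seed to a vector in $\mathbb Z_q^n$. (c) A garbling scheme (GC) for Boolean circuits with two labels per input and output wire: evaluating the garbled circuit on the labels of an input $x$ yields the labels of the circuit's output on $x$, and the two labels of an output wire are distinct. (d) A polynomial-size circuit $C$ computing from $q$, $u_0$, $u_1\in\mathbb Z_q^n$ the vector $\mathrm{msb}(u_{0}-u_{1})$; here,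 for $x\in\mathbb Z_q$ represented in $[0,q)$, $\mathrm{msb}(x)$ is its $b$-th binary digit, where $b$ is the number of bits needed for the values in $[0,q)$ (so it is the sign bit of encoded integers that do not overflow). **Ideal functionality.** $\mathcal F(m_{Cloud},m_{CSP})\to I_t$, where $m_{Cloud}=(Z_0,w_t)$ and $m_{CSP}=Z_1$ with $Z_0,Z_1\in\mathbb Z_q^{n\times d}$ the shares of the data $Z=Z_0+Z_1$ and $w_t\in\mathbb Z_q^d$. Its output $I_t\in\{0,1\}^n$, delivered to CSP only, has $I_{t,i}=1$ if $\mathrm{msb}((Zw_t)_i)=0$ and $I_{t,i}=0$ otherwise. **The SecSh+GC construction.** Setup: Cloud generates an AHE key pair and publishes $pk$. Iteration $t$: (1) Cloud sends $E(w_t)$. (2) CSP computes $\lambda_t=\mathcal G(\text{random seed})$, homomorphically computes $Z_1E(w_t)$ from additions, adds a fresh $E(\lambda_t)$, and sends the result, an encryption of $Z_1w_t+\lambda_t$. (3) Cloud decrypts and sets $u_{0}=Z_0w_t+(Z_1w_t+\lambda_t)$; CSP has $u_{1}=\lambda_t$. (4) CSP garbles $C$ and sends the garbled circuit and the labels of its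 own inputs $q,u_1$; Cloud receives the labels of $u_0$ through (ideal) 1-out-of-2 oblivious transfer, evaluates, and returns the output labels. (5) CSP maps them to the bits $\mathrm{msb}(u_0-u_1)$ and outputs their complements $I_t$. **Theorem 2.** Assume that * $\mathcal G$ is pseudo-random: for all moduli $q=q(k)<2^{B(k)}$ its output on a random seed is $\approx_c$ a uniform vector in $\mathbb Z_q^n$; * the AHE scheme is CPA-secure (IND-CPA); * GC is CPA-secure: for every polynomial-size family of circuits and any two inputs $x_0,x_1$, the garbled circuit together with the labels of $x_0$ is $\approx_c$ the garbled circuit together with the labels of $x_1$ (the output label table being withheld). Then the SecSh+GC construction securely computes $I_t$ against honest-but-curious adversaries, that is, it UC-realizes $\mathcal F(m_{Cloud},m_{CSP})\to I_t$: for each corrupted party (Cloud or CSP) and each PPT adversary $\mathcal A$, which gets the view of that party (its input, its random coins, including for Cloud those of the key generation, $pk$, and all messages it receives) and a message from the environment, and reports to the environment, there is a PPT simulator $\mathcal S$, which gets only the party's setup information ($pk$; for Cloud its key generation coins), its input, its output from $\mathcal F$ (nothing for Cloud, $I_t$ for CSP) and the environment's message, such that for every PPT environment $\mathcal Z$ $$\bigl|\Pr[\mathrm{Real}_{\pi,\mathcal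 A,\mathcal Z}(k)=1]-\Pr[\mathrm{Ideal}_{\mathcal F,\mathcal S,\mathcal Z}(k)=1]\bigr|$$ is negligible in $k$. Here $\mathcal Z$ chooses, after the setup and knowing the corrupted party's setup information, all inputs and the message, and outputs a bit after seeing the report and CSP's output (computed by the protocol in Real, by $\mathcal F$ in Ideal). -/

import Mathlib

/-! ### Bit strings, Boolean circuits, non-uniform polynomial time -/

/-- Bit strings of length `n`. -/
abbrev Bits (n : ℕ) : Type := Fin n → Bool

/-- Boolean circuits with input wires `ι` and output wires `κ`, as straight-line programs: each gate
adds one wire (`none`), the earlier wires being `some i`; at the end every output is one of the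
wires present. -/
inductive Circ : Type → Type → Type 1
  | out {ι κ : Type} (f : κ → ι) : Circ ι κ
  | const {ι κ : Type} (b : Bool) (C : Circ (Option ι) κ) : Circ ι κ
  | gate {ι κ : Type} (op : Bool → Bool → Bool) (i j : ι) (C : Circ (Option ι) κ) : Circ ι κ

namespace Circ

/-- The function computed by a circuit. -/
def eval : {ι κ : Type} → Circ ι κ → (ι → Bool) → (κ → Bool)
  | _, _, out f, x => fun o => x (f o)
  | _, _, const b C, x => C.eval (fun a => a.elim b x)
  | _, _, gate op i j C, x => C.eval (fun a => a.elim (op (x i) (x j)) x)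

/-- The number of gates. -/
def gates : {ι κ : Type} → Circ ι κ → ℕ
  | _, _, out _ => 0
  | _, _, const _ C => C.gates + 1
  | _, _, gate _ _ _ C => C.gates + 1

/-- The size: gates, input wires and output wires. -/
def size {ι κ : Type} [Fintype ι] [Fintype κ] (C : Circ ι κ) : ℕ :=
  C.gates + Fintype.card ι + Fintype.card κ

end Circ

/-- A length or size that is at most a polynomial in the security parameter. -/
def PolyBounded (f : ℕ → ℕ) : Prop := ∃ p : Polynomial ℕ, ∀ k, f k ≤ p.eval k

/-- `out k a` is computed from `inp k a`, for all `a : α k`, by circuits of size polynomial in `k`.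
(`inp` and `out` are the bit encodings of the argument and of the value of a function.) -/
def PolyComputable {α ι κ : ℕ → Type} [∀ k, Fintype (ι k)] [∀ k, Fintype (κ k)]
    (inp : ∀ k, α k → ι k → Bool) (out : ∀ k, α k → κ k → Bool) : Prop :=
  ∃ p : Polynomial ℕ, ∀ k, ∃ C : Circ (ι k) (κ k),
    C.size ≤ p.eval k ∧ ∀ a : α k, C.eval (inp k a) = out k a

/-- The uniform distribution. -/
noncomputable abbrev unif (α : Type) [Fintype α] [Nonempty α] : PMF α := PMF.uniformOfFintype α

/-- A (non-uniform) probabilistic polynomial-time algorithm with input bits `ι k` and output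
bits `κ k`; it tosses `coins k` fair coins. -/
structure PPT (ι κ : ℕ → Type) [∀ k, Fintype (ι k)] [∀ k, Fintype (κ k)] where
  coins : ℕ → ℕ
  run : ∀ k, (ι k → Bool) → Bits (coins k) → (κ k → Bool)
  poly : PolyComputable (α := fun k => (ι k → Bool) × Bits (coins k))
    (fun _ a => Sum.elim a.1 a.2) (fun k a => run k a.1 a.2)

/-- The output distribution of an algorithm on a given input. -/
noncomputable def PPT.dist {ι κ : ℕ → Type} [∀ k, Fintype (ι k)] [∀ k, Fintype (κ k)]
    (D : PPT ι κ) (k : ℕ) (x : ι k → Bool) : PMF (κ k → Bool) :=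
  (unif (Bits (D.coins k))).map (D.run k x)

/-- Algorithms with a one-bit answer. -/
abbrev Distinguisher (ι : ℕ → Type) [∀ k, Fintype (ι k)] : Type := PPT ι (fun _ => Unit)

/-- The answer of a distinguisher. -/
noncomputable def PPT.bit {ι : ℕ → Type} [∀ k, Fintype (ι k)]
    (D : Distinguisher ι) (k : ℕ) (x : ι k → Bool) : PMF Bool :=
  (D.dist k x).map (fun y => y ())

/-- Negligible functions of the security parameter. -/
def Negligible (f : ℕ → ℝ) : Prop :=
  Asymptotics.SuperpolynomialDecay Filter.atTop (fun k : ℕ => (k : ℝ)) f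

/-- `|Pr[p k = 1] - Pr[q k = 1]|` is negligible. -/
def NegligibleGap (p q : ℕ → PMF Bool) : Prop :=
  Negligible (fun k => |(p k true).toReal - (q k true).toReal|)

/-- Statistical distance. -/
noncomputable def statDist {α : Type} [Fintype α] (p q : PMF α) : ℝ :=
  (1 / 2) * ∑ x, |(p x).toReal - (q x).toReal|

/-! ### Residues and their encoding -/

/-- Positive moduli `q` with fewer than `B + 1` bits. -/
abbrev Modulus (B : ℕ) : Type := {q : ℕ // 0 < q ∧ q < 2 ^ B}

instance Modulus.neZero {B : ℕ} (q : Modulus B) : NeZero (q : ℕ) := ⟨q.2.1.ne'⟩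

/-- The `B` low-order binary digits of a number. -/
def natBits (B x : ℕ) : Bits B := fun i => x.testBit i

/-- The binary encoding, `B` bits per entry, of a family of residues in `[0, q)`. -/
def resBits {ι : Type} {q : ℕ} (B : ℕ) (v : ι → ZMod q) : ι × Fin B → Bool :=
  fun p => (v p.1).val.testBit p.2

/-- The same for matrices. -/
def matBits {ι κ : Type} {q : ℕ} (B : ℕ) (M : Matrix ι κ (ZMod q)) : (ι × κ) × Fin B → Bool :=
  resBits B (fun p : ι × κ => M p.1 p.2)

/-- The most significant bit of a residue: the `b`-th binary digit of its representative in
`[0, q)`, where `b` is the number of bits needed for the values in `[0, q)`. -/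
def msb {q : ℕ} (x : ZMod q) : Bool := x.val.testBit (Nat.size (q - 1) - 1)

/-! ### Additive homomorphic encryption -/

/-- Additive homomorphic public-key encryption; the plaintexts are the residues modulo a number
`modulus k pk` that may depend on the public key. Homomorphic addition `add` satisfies
`E(α + β) = add (E(α), E(β))` both as sets of ciphertexts (`add_enc`) and, when the second
encryption is fresh, as distributions up to a negligible statistical error (`add_fresh`). -/
structure AHE where
  (pkLen skLen ctLen msgLen genCoins encCoins : ℕ → ℕ)
  gen : ∀ k, Bits (genCoins k) → Bits (pkLen k) × Bits (skLen k)
  modulus : ∀ k, Bits (pkLen k) → Modulus (msgLen k)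
  enc : ∀ k (pk : Bits (pkLen k)), ZMod (modulus k pk) → Bits (encCoins k) → Bits (ctLen k)
  dec : ∀ k (pk : Bits (pkLen k)), Bits (skLen k) → Bits (ctLen k) → ZMod (modulus k pk)
  add : ∀ k, Bits (pkLen k) → Bits (ctLen k) → Bits (ctLen k) → Bits (ctLen k)
  gen_poly : PolyComputable (α := fun k => Bits (genCoins k))
    (fun _ g => g) (fun k g => Sum.elim (gen k g).1 (gen k g).2)
  modulus_poly : PolyComputable (α := fun k => Bits (pkLen k))
    (fun _ pk => pk) (fun k pk => natBits (msgLen k) (modulus k pk))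
  enc_poly : PolyComputable
    (α := fun k => (pk : Bits (pkLen k)) × ZMod (modulus k pk) × Bits (encCoins k))
    (fun k a => Sum.elim a.1 (Sum.elim (natBits (msgLen k) a.2.1.val) a.2.2))
    (fun k a => enc k a.1 a.2.1 a.2.2)
  dec_poly : PolyComputable (α := fun k => Bits (pkLen k) × Bits (skLen k) × Bits (ctLen k))
    (fun _ a => Sum.elim a.1 (Sum.elim a.2.1 a.2.2))
    (fun k a => natBits (msgLen k) (dec k a.1 a.2.1 a.2.2).val)
  add_poly : PolyComputable (α := fun k => Bits (pkLen k) × Bits (ctLen k) × Bits (ctLen k))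
    (fun _ a => Sum.elim a.1 (Sum.elim a.2.1 a.2.2)) (fun k a => add k a.1 a.2.1 a.2.2)
  dec_enc : ∀ k (g : Bits (genCoins k)) (m : ZMod (modulus k (gen k g).1))
    (r : Bits (encCoins k)), dec k (gen k g).1 (gen k g).2 (enc k (gen k g).1 m r) = m
  add_enc : ∀ k (g : Bits (genCoins k)) (m m' : ZMod (modulus k (gen k g).1))
    (r r' : Bits (encCoins k)), ∃ r'' : Bits (encCoins k),
      add k (gen k g).1 (enc k (gen k g).1 m r) (enc k (gen k g).1 m' r')
        = enc k (gen k g).1 (m + m') r''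
  add_fresh : ∃ ε : ℕ → ℝ, Negligible ε ∧
    ∀ k (g : Bits (genCoins k)) (m m' : ZMod (modulus k (gen k g).1)) (r : Bits (encCoins k)),
      statDist
        ((unif (Bits (encCoins k))).map
          (fun r' => add k (gen k g).1 (enc k (gen k g).1 m r) (enc k (gen k g).1 m' r')))
        ((unif (Bits (encCoins k))).map (enc k (gen k g).1 (m + m'))) ≤ ε k

namespace AHE

/-- A chosen-plaintext attacker: it sees the public key, chooses two plaintexts, keeps a state, and
is then given the encryption of one of the two. -/
structure Attacker (E : AHE) where
  (coins stLen : ℕ → ℕ)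
  choose : ∀ k (pk : Bits (E.pkLen k)), Bits (coins k) →
    (ZMod (E.modulus k pk) × ZMod (E.modulus k pk)) × Bits (stLen k)
  choose_poly : PolyComputable (α := fun k => Bits (E.pkLen k) × Bits (coins k))
    (fun _ a => Sum.elim a.1 a.2)
    (fun k a => Sum.elim
      (Sum.elim (natBits (E.msgLen k) (choose k a.1 a.2).1.1.val)
        (natBits (E.msgLen k) (choose k a.1 a.2).1.2.val))
      (choose k a.1 a.2).2)
  guess : Distinguisher (fun k => Fin (stLen k) ⊕ Fin (E.ctLen k))

/-- The chosen-plaintext experiment, in which the plaintext number `b` is encrypted. -/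
noncomputable def cpaGame (E : AHE) (A : E.Attacker) (b : Bool) (k : ℕ) : PMF Bool := do
  let g ← unif (Bits (E.genCoins k))
  let pk := (E.gen k g).1
  let ρ ← unif (Bits (A.coins k))
  let ch := A.choose k pk ρ
  let r ← unif (Bits (E.encCoins k))
  A.guess.bit k (Sum.elim ch.2 (E.enc k pk (if b then ch.1.2 else ch.1.1) r))

/-- Security against chosen-plaintext attacks. -/
def CPASecure (E : AHE) : Prop :=
  ∀ A : E.Attacker, NegligibleGap (E.cpaGame A false) (E.cpaGame A true)

/-- A fixed encryption of zero, from which homomorphic sums start. -/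
def encZero (E : AHE) (k : ℕ) (pk : Bits (E.pkLen k)) : Bits (E.ctLen k) :=
  E.enc k pk 0 (fun _ => false)

/-- Pseudo-homomorphic multiplication of a ciphertext by the plaintext number formed by the `t`
low-order bits of `z`, as a repeated homomorphic addition (double-and-add). -/
def smul (E : AHE) (k : ℕ) (pk : Bits (E.pkLen k)) :
    ℕ → ℕ → Bits (E.ctLen k) → Bits (E.ctLen k)
  | 0, _, _ => E.encZero k pk
  | t + 1, z, c =>
    let a := smul E k pk t (z / 2) c
    if z % 2 = 1 then E.add k pk (E.add k pk a a) c else E.add k pk a a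

/-- Pseudo-homomorphic product of a plaintext matrix with an encrypted vector. -/
def mulVec (E : AHE) (k : ℕ) (pk : Bits (E.pkLen k)) {n d : ℕ}
    (Z : Matrix (Fin n) (Fin d) (ZMod (E.modulus k pk))) (c : Fin d → Bits (E.ctLen k)) :
    Fin n → Bits (E.ctLen k) :=
  fun i => (List.finRange d).foldl
    (fun acc j => E.add k pk acc (E.smul k pk (E.msgLen k) (Z i j).val (c j))) (E.encZero k pk)

end AHE

/-! ### Pseudo-random generators of noise vectors -/

/-- An efficient generator that stretches a seed to a vector of `n k` residues modulo any given
number below `2 ^ B k`. -/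
structure NoiseGen (n B : ℕ → ℕ) where
  seedLen : ℕ → ℕ
  gen : ∀ k (q : Modulus (B k)), Bits (seedLen k) → Fin (n k) → ZMod q
  gen_poly : PolyComputable (α := fun k => Modulus (B k) × Bits (seedLen k))
    (fun k a => Sum.elim (natBits (B k) a.1) a.2) (fun k a => resBits (B k) (gen k a.1 a.2))

/-- The generator is pseudo-random: its output is computationally indistinguishable from a uniform
vector of residues. -/
def NoiseGen.PseudoRandom {n B : ℕ → ℕ} (G : NoiseGen n B) : Prop :=
  ∀ (q : ∀ k, Modulus (B k)) (D : Distinguisher (fun k => Fin (n k) × Fin (B k))),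
    NegligibleGap
      (fun k => (unif (Bits (G.seedLen k))).bind
        (fun s => D.bit k (resBits (B k) (G.gen k (q k) s))))
      (fun k => (unif (Fin (n k) → ZMod (q k))).bind (fun v => D.bit k (resBits (B k) v)))

/-! ### Garbled circuits -/

/-- The result of garbling: the garbled circuit, and the two labels (one per bit) of every input
wire and of every output wire. -/
structure Garbled (ι κ : Type) (gcLen labelLen : ℕ) where
  gc : Bits gcLen
  inLabel : ι → Bool → Bits labelLen
  outLabel : κ → Bool → Bits labelLen

/-- The bits of a garbling. -/
def Garbled.bits {ι κ : Type} {m l : ℕ} (g : Garbled ι κ m l) :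
    Fin m ⊕ (ι × Bool) × Fin l ⊕ (κ × Bool) × Fin l → Bool :=
  Sum.elim g.gc (Sum.elim (fun p => g.inLabel p.1.1 p.1.2 p.2)
    (fun p => g.outLabel p.1.1 p.1.2 p.2))

/-- Garbled circuits. Evaluating a garbled circuit on the labels of the bits of `x` gives the labels
of the bits of the output of the circuit on `x`; the two labels of an output wire differ, so that the
garbler can map output labels back to bits. -/
structure GarblingScheme where
  labelLen : ℕ → ℕ
  coins : ∀ (_ : ℕ) {ι κ : Type} [Finite ι] [Finite κ], Circ ι κ → ℕ
  gcLen : ∀ (_ : ℕ) {ι κ : Type} [Finite ι] [Finite κ], Circ ι κ → ℕ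
  garble : ∀ (k : ℕ) {ι κ : Type} [Finite ι] [Finite κ] (C : Circ ι κ),
    Bits (coins k C) → Garbled ι κ (gcLen k C) (labelLen k)
  eval : ∀ (k : ℕ) {ι κ : Type} [Finite ι] [Finite κ] (C : Circ ι κ),
    Bits (gcLen k C) → (ι → Bits (labelLen k)) → (κ → Bits (labelLen k))
  garble_poly : ∀ (ι κ : ℕ → Type) [∀ k, Fintype (ι k)] [∀ k, Fintype (κ k)]
    (C : ∀ k, Circ (ι k) (κ k)), PolyBounded (fun k => (C k).size) →
    PolyComputable (α := fun k => Bits (coins k (C k)))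
      (fun _ r => r) (fun k r => (garble k (C k) r).bits)
  eval_poly : ∀ (ι κ : ℕ → Type) [∀ k, Fintype (ι k)] [∀ k, Fintype (κ k)]
    (C : ∀ k, Circ (ι k) (κ k)), PolyBounded (fun k => (C k).size) →
    PolyComputable (α := fun k => Bits (gcLen k (C k)) × (ι k → Bits (labelLen k)))
      (fun _ a => Sum.elim a.1 (fun p : _ × _ => a.2 p.1 p.2))
      (fun k a => fun p : _ × _ => eval k (C k) a.1 a.2 p.1 p.2)
  eval_garble : ∀ (k : ℕ) {ι κ : Type} [Finite ι] [Finite κ] (C : Circ ι κ)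
    (r : Bits (coins k C)) (x : ι → Bool),
    eval k C (garble k C r).gc (fun i => (garble k C r).inLabel i (x i))
      = fun o => (garble k C r).outLabel o (C.eval x o)
  outLabel_ne : ∀ (k : ℕ) {ι κ : Type} [Finite ι] [Finite κ] (C : Circ ι κ)
    (r : Bits (coins k C)) (o : κ), (garble k C r).outLabel o false ≠ (garble k C r).outLabel o true

namespace GarblingScheme

/-- The garbled circuit together with the labels of the input `x`: what the evaluator receives. -/
noncomputable def encrypt (Γ : GarblingScheme) (k : ℕ) {ι κ : Type} [Finite ι] [Finite κ]
    (C : Circ ι κ) (x : ι → Bool) :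
    PMF (Fin (Γ.gcLen k C) ⊕ ι × Fin (Γ.labelLen k) → Bool) :=
  (unif (Bits (Γ.coins k C))).map (fun r => Sum.elim (Γ.garble k C r).gc
    (fun p => (Γ.garble k C r).inLabel p.1 (x p.1) p.2))

/-- Security of garbled circuits against chosen-plaintext attacks: for a circuit and two inputs of
the attacker's choice, the garbled circuit with the labels of the first input is computationally
indistinguishable from the garbled circuit with the labels of the second one (for an evaluator
without the output label table, so that the output stays encrypted as well). -/
def CPASecure (Γ : GarblingScheme) : Prop :=
  ∀ (ι κ : ℕ → Type) [∀ k, Fintype (ι k)] [∀ k, Fintype (κ k)]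
    (C : ∀ k, Circ (ι k) (κ k)), PolyBounded (fun k => (C k).size) →
    ∀ (x₀ x₁ : ∀ k, ι k → Bool)
      (D : Distinguisher (fun k => Fin (Γ.gcLen k (C k)) ⊕ ι k × Fin (Γ.labelLen k))),
      NegligibleGap (fun k => (Γ.encrypt k (C k) (x₀ k)).bind (D.bit k))
        (fun k => (Γ.encrypt k (C k) (x₁ k)).bind (D.bit k))

end GarblingScheme

/-! ### The SecSh+GC construction -/

/-- Input wires of the sign-checking circuit: CSP's inputs, namely the modulus and the noise
vector, and Cloud's input, the noisy vector. -/
abbrev SignIn (n B : ℕ) : Type := (Fin B ⊕ Fin n × Fin B) ⊕ Fin n × Fin B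

/-- CSP's input bits to the sign-checking circuit: the public modulus `q` and the noise `u₁`. -/
def cspBits {n B : ℕ} (q : Modulus B) (u₁ : Fin n → ZMod q) : Fin B ⊕ Fin n × Fin B → Bool :=
  Sum.elim (natBits B q) (resBits B u₁)

/-- The ingredients of the construction, for `n k` records of dimension `d k`: an AHE scheme, a
pseudo-random number generator, a garbling scheme, and a polynomial-size Boolean circuit which
computes the most significant bits of `u₀ - u₁`. -/
structure SecShGC (n d : ℕ → ℕ) where
  E : AHE
  G : NoiseGen n E.msgLen
  Γ : GarblingScheme
  circ : ∀ k, Circ (SignIn (n k) (E.msgLen k)) (Fin (n k))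
  circ_poly : PolyBounded (fun k => (circ k).size)
  circ_eval : ∀ k (g : Bits (E.genCoins k)) (u₀ u₁ : Fin (n k) → ZMod (E.modulus k (E.gen k g).1)),
    (circ k).eval (Sum.elim (cspBits _ u₁) (resBits _ u₀)) = fun i => msb (u₀ i - u₁ i)

/-- The two computing parties. -/
inductive Party
  | cloud
  | csp

/-- The inputs of the two parties for one iteration: Cloud's data share `Z₀` and its linear
classifier `w`, and CSP's data share `Z₁`. -/
structure Inputs (n d q : ℕ) where
  Z₀ : Matrix (Fin n) (Fin d) (ZMod q)
  w : Fin d → ZMod q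
  Z₁ : Matrix (Fin n) (Fin d) (ZMod q)

/-- The bits of the inputs. -/
def Inputs.bits {n d q : ℕ} (B : ℕ) (x : Inputs n d q) :
    (Fin n × Fin d) × Fin B ⊕ Fin d × Fin B ⊕ (Fin n × Fin d) × Fin B → Bool :=
  Sum.elim (matBits B x.Z₀) (Sum.elim (resBits B x.w) (matBits B x.Z₁))

/-- The ideal function `F (m_Cloud, m_CSP) = I`, with `m_Cloud = (Z₀, w)` and `m_CSP = Z₁`: the
entry of the indicator vector is 1 when the sign bit of the entry of `Z w`, `Z = Z₀ + Z₁`,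
is 0, that is, when the sample is classified correctly. -/
def idealF {n d q : ℕ} (x : Inputs n d q) : Fin n → Bool :=
  fun i => !msb ((x.Z₀ + x.Z₁).mulVec x.w i)

/-- Ideal 1-out-of-2 oblivious transfer: the receiver gets the chosen one of each pair. -/
def idealOT {ι α : Type} (pairs : ι → Bool → α) (choice : ι → Bool) : ι → α :=
  fun i => pairs i (choice i)

namespace SecShGC

variable {n d : ℕ → ℕ} (P : SecShGC n d)

/-- The public key from Cloud's key generation coins. -/
abbrev pk (k : ℕ) (g : Bits (P.E.genCoins k)) : Bits (P.E.pkLen k) := (P.E.gen k g).1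

/-- The plaintext modulus belonging to a public key. -/
abbrev q (k : ℕ) (pk : Bits (P.E.pkLen k)) : Modulus (P.E.msgLen k) := P.E.modulus k pk

/-- Cloud's coins in an iteration: one encryption per entry of `w`. -/
abbrev CloudTape (k : ℕ) : Type := Fin (d k) → Bits (P.E.encCoins k)

/-- CSP's coins in an iteration: the seed of the noise, the coins of the encryptions of the noise,
and the garbling coins. -/
abbrev CSPTape (k : ℕ) : Type :=
  Bits (P.G.seedLen k) × (Fin (n k) → Bits (P.E.encCoins k)) × Bits (P.Γ.coins k (P.circ k))

/-- Everything that is computed and sent in one iteration. -/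
structure Transcript (k : ℕ) where
  /-- Cloud to CSP: the encrypted classifier `E(w)`. -/
  encW : Fin (d k) → Bits (P.E.ctLen k)
  /-- CSP to Cloud: `E(Z₁ w + noise)`. -/
  encNoisy : Fin (n k) → Bits (P.E.ctLen k)
  /-- CSP to Cloud: the garbled circuit. -/
  gc : Bits (P.Γ.gcLen k (P.circ k))
  /-- CSP to Cloud: the labels of CSP's inputs. -/
  cspLabels : Fin (P.E.msgLen k) ⊕ Fin (n k) × Fin (P.E.msgLen k) → Bits (P.Γ.labelLen k)
  /-- Received by Cloud through oblivious transfer: the labels of Cloud's inputs. -/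
  cloudLabels : Fin (n k) × Fin (P.E.msgLen k) → Bits (P.Γ.labelLen k)
  /-- Cloud to CSP: the output labels. -/
  outLabels : Fin (n k) → Bits (P.Γ.labelLen k)
  /-- CSP's output: the indicator vector. -/
  indicator : Fin (n k) → Bool

/-- One iteration of the protocol between Cloud (key generation coins `g`, coins `r`) and CSP
(coins `s`), executed honestly. -/
def exec (k : ℕ) (g : Bits (P.E.genCoins k)) (x : Inputs (n k) (d k) (P.q k (P.pk k g)))
    (r : P.CloudTape k) (s : P.CSPTape k) : P.Transcript k :=
  let pk := P.pk k g
  -- Cloud encrypts its classifier.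
  let encW := fun j => P.E.enc k pk (x.w j) (r j)
  -- CSP multiplies homomorphically by its share and adds encrypted pseudo-random noise.
  let u₁ := P.G.gen k (P.q k pk) s.1
  let prod := P.E.mulVec k pk x.Z₁ encW
  let encNoisy := fun i => P.E.add k pk (prod i) (P.E.enc k pk (u₁ i) (s.2.1 i))
  -- Cloud decrypts and adds its own part.
  let u₀ := fun i => x.Z₀.mulVec x.w i + P.E.dec k pk (P.E.gen k g).2 (encNoisy i)
  -- CSP garbles the circuit; the input labels are transferred.
  let gb := P.Γ.garble k (P.circ k) s.2.2
  let cspLabels := fun i => gb.inLabel (Sum.inl i) (cspBits (P.q k pk) u₁ i)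
  let cloudLabels := idealOT (fun i => gb.inLabel (Sum.inr i)) (resBits (P.E.msgLen k) u₀)
  -- Cloud evaluates the garbled circuit and returns the output labels.
  let outLabels := P.Γ.eval k (P.circ k) gb.gc (Sum.elim cspLabels cloudLabels)
  -- CSP maps the labels back to sign bits; a sign bit 0 gives indicator 1.
  let indicator := fun i => !decide (outLabels i = gb.outLabel i true)
  ⟨encW, encNoisy, gb.gc, cspLabels, cloudLabels, outLabels, indicator⟩

/-- The bits of a party's view in one iteration: its input, its coins (for Cloud also those of the
key generation), the public key, and all messages received. -/
@[reducible]
def ViewIdx : Party → ℕ → Type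
  | .cloud, k =>
    (Fin (P.E.genCoins k) ⊕ (Fin (n k) × Fin (d k)) × Fin (P.E.msgLen k) ⊕
      Fin (d k) × Fin (P.E.msgLen k) ⊕ Fin (d k) × Fin (P.E.encCoins k)) ⊕
    (Fin (n k) × Fin (P.E.ctLen k) ⊕ Fin (P.Γ.gcLen k (P.circ k)) ⊕
      (Fin (P.E.msgLen k) ⊕ Fin (n k) × Fin (P.E.msgLen k)) × Fin (P.Γ.labelLen k) ⊕
      (Fin (n k) × Fin (P.E.msgLen k)) × Fin (P.Γ.labelLen k))
  | .csp, k =>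
    (Fin (P.E.pkLen k) ⊕ (Fin (n k) × Fin (d k)) × Fin (P.E.msgLen k) ⊕ Fin (P.G.seedLen k) ⊕
      Fin (n k) × Fin (P.E.encCoins k) ⊕ Fin (P.Γ.coins k (P.circ k))) ⊕
    (Fin (d k) × Fin (P.E.ctLen k) ⊕ Fin (n k) × Fin (P.Γ.labelLen k))

instance viewIdxFintype : ∀ (c : Party) (k : ℕ), Fintype (P.ViewIdx c k)
  | .cloud, _ => inferInstance
  | .csp, _ => inferInstance

/-- The view of a party. -/
def view (c : Party) (k : ℕ) (g : Bits (P.E.genCoins k))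
    (x : Inputs (n k) (d k) (P.q k (P.pk k g))) (r : P.CloudTape k) (s : P.CSPTape k) :
    P.ViewIdx c k → Bool :=
  let τ := P.exec k g x r s
  match c with
  | .cloud => Sum.elim
      (Sum.elim g (Sum.elim (matBits _ x.Z₀) (Sum.elim (resBits _ x.w) (fun p => r p.1 p.2))))
      (Sum.elim (fun p => τ.encNoisy p.1 p.2) (Sum.elim τ.gc
        (Sum.elim (fun p => τ.cspLabels p.1 p.2) (fun p => τ.cloudLabels p.1 p.2))))
  | .csp => Sum.elim
      (Sum.elim (P.pk k g) (Sum.elim (matBits _ x.Z₁) (Sum.elim s.1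
        (Sum.elim (fun p => s.2.1 p.1 p.2) s.2.2))))
      (Sum.elim (fun p => τ.encW p.1 p.2) (fun p => τ.outLabels p.1 p.2))

/-- The bits that a corrupted party has in the ideal process: its setup information (Cloud: its key
generation coins; CSP: the public key), its input, and its output from the ideal functionality
(Cloud: nothing; CSP: the indicator vector). -/
@[reducible]
def IdealIdx : Party → ℕ → Type
  | .cloud, k => Fin (P.E.genCoins k) ⊕ (Fin (n k) × Fin (d k)) × Fin (P.E.msgLen k) ⊕
      Fin (d k) × Fin (P.E.msgLen k)
  | .csp, k => Fin (P.E.pkLen k) ⊕ (Fin (n k) × Fin (d k)) × Fin (P.E.msgLen k) ⊕ Fin (n k)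

instance idealIdxFintype : ∀ (c : Party) (k : ℕ), Fintype (P.IdealIdx c k)
  | .cloud, _ => inferInstance
  | .csp, _ => inferInstance

/-- What a corrupted party has in the ideal process. -/
def idealView (c : Party) (k : ℕ) (g : Bits (P.E.genCoins k))
    (x : Inputs (n k) (d k) (P.q k (P.pk k g))) : P.IdealIdx c k → Bool :=
  match c with
  | .cloud => Sum.elim g (Sum.elim (matBits _ x.Z₀) (resBits _ x.w))
  | .csp => Sum.elim (P.pk k g) (Sum.elim (matBits _ x.Z₁) (idealF x))

/-- The number of secret setup bits of a corrupted party: Cloud has the key generation coins. -/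
def secretLen : Party → ℕ → ℕ
  | .cloud, k => P.E.genCoins k
  | .csp, _ => 0

/-- The secret setup bits of a corrupted party. -/
def secret (c : Party) (k : ℕ) (g : Bits (P.E.genCoins k)) : Bits (P.secretLen c k) :=
  match c with
  | .cloud => g
  | .csp => Fin.elim0

/-- An adversary corrupting the party `c`. It is honest-but-curious: it gets the view of the corrupted
party and a message from the environment, and reports to the environment. -/
abbrev Adversary (c : Party) (inLen outLen : ℕ → ℕ) : Type :=
  PPT (fun k => P.ViewIdx c k ⊕ Fin (inLen k)) (fun k => Fin (outLen k))

/-- A simulator: it gets what the corrupted party has in the ideal process and the environment's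
message to the adversary, and reports to the environment. -/
abbrev Simulator (c : Party) (inLen outLen : ℕ → ℕ) : Type :=
  PPT (fun k => P.IdealIdx c k ⊕ Fin (inLen k)) (fun k => Fin (outLen k))

/-- An environment. After the setup it chooses the inputs of both parties, a message to the adversary
and a state; at the end it sees the adversary's report and CSP's output, and answers a bit. -/
structure Environment (c : Party) (inLen outLen : ℕ → ℕ) where
  (coins stLen : ℕ → ℕ)
  choose : ∀ k (pk : Bits (P.E.pkLen k)), Bits (P.secretLen c k) → Bits (coins k) →
    Inputs (n k) (d k) (P.q k pk) × Bits (inLen k) × Bits (stLen k)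
  choose_poly : PolyComputable
    (α := fun k => Bits (P.E.pkLen k) × Bits (P.secretLen c k) × Bits (coins k))
    (fun _ a => Sum.elim a.1 (Sum.elim a.2.1 a.2.2))
    (fun k a => Sum.elim ((choose k a.1 a.2.1 a.2.2).1.bits (P.E.msgLen k))
      (Sum.elim (choose k a.1 a.2.1 a.2.2).2.1 (choose k a.1 a.2.1 a.2.2).2.2))
  answer : Distinguisher (fun k => Fin (stLen k) ⊕ Fin (outLen k) ⊕ Fin (n k))

/-- The environment's answer in the real process. -/
noncomputable def real {c : Party} {inLen outLen : ℕ → ℕ} (A : P.Adversary c inLen outLen)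
    (Z : P.Environment c inLen outLen) (k : ℕ) : PMF Bool := do
  let g ← unif (Bits (P.E.genCoins k))
  let ρ ← unif (Bits (Z.coins k))
  let ch := Z.choose k (P.pk k g) (P.secret c k g) ρ
  let r ← unif (P.CloudTape k)
  let s ← unif (P.CSPTape k)
  let report ← A.dist k (Sum.elim (P.view c k g ch.1 r s) ch.2.1)
  Z.answer.bit k (Sum.elim ch.2.2 (Sum.elim report (P.exec k g ch.1 r s).indicator))

/-- The environment's answer in the ideal process. -/
noncomputable def ideal {c : Party} {inLen outLen : ℕ → ℕ} (S : P.Simulator c inLen outLen)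
    (Z : P.Environment c inLen outLen) (k : ℕ) : PMF Bool := do
  let g ← unif (Bits (P.E.genCoins k))
  let ρ ← unif (Bits (Z.coins k))
  let ch := Z.choose k (P.pk k g) (P.secret c k g) ρ
  let report ← S.dist k (Sum.elim (P.idealView c k g ch.1) ch.2.1)
  Z.answer.bit k (Sum.elim ch.2.2 (Sum.elim report (idealF ch.1)))

/-- The protocol UC-realizes the ideal functionality against honest-but-curious adversaries that
corrupt one of the two parties. -/
def UCRealizes : Prop :=
  ∀ (c : Party) (inLen outLen : ℕ → ℕ) (A : P.Adversary c inLen outLen),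
    ∃ S : P.Simulator c inLen outLen, ∀ Z : P.Environment c inLen outLen,
      NegligibleGap (P.real A Z) (P.ideal S Z)

end SecShGC

/-!
Both corruption cases are hybrid arguments, and all reductions are non-uniform: by
`Negligible.exists_bound`, every coin that a reduction need not sample is fixed, for each `k`, to its
most favourable value and hard-wired into the circuit. Probabilities are averages over uniform coins
(`Finset.expect`), and in both cases the honest execution is first replaced by closed formulas for
its messages (`SecShGC.exec_eq`); in particular CSP's output is always that of the ideal
functionality, so only the report of the adversary has to be simulated.

*Cloud corrupted* (`SecShGC.cloud_secure`). The simulator sends Cloud fresh encryptions of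
pseudo-random noise and a garbled circuit with the labels of the all-false input. From the real
process to the simulation: security of garbling replaces the input of the garbled circuit by the
all-false one (`cloud_garbling_bound`); pseudo-randomness replaces the noise by uniform noise `u`;
the sums `E(Z₁ w) + E(u)` are statistically close to fresh encryptions of `Z₁ w + u`, which is
uniform like `u` (`cloud_rerandomization_bound`); pseudo-randomness, used backwards, replaces
`u` by generator output, since a simulator made of circuits cannot sample residues modulo `q`
exactly. In the first use of pseudo-randomness the distinguisher has the ciphertexts `E(Z₁ w)`
hard-wired and adds to them homomorphically, so no arithmetic modulo `q` is needed.

*CSP corrupted* (`SecShGC.csp_secure`). The simulator sends CSP encryptions of zero instead of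
`E(w)`, and the output labels determined by CSP's output and CSP's garbling coins. The entries of `w`
are replaced by zero one at a time, each time by security of the encryption
(`csp_encryption_bound`). The public key is random here, so the attacker has to compute CSP's
output from the inputs chosen by the environment: a modular matrix-vector product
(`BitwisePoly.mulVec`, from ripple-carry addition and double-and-add multiplication), followed by the
given sign-checking circuit with noise zero.

Efficiency is tracked bit by bit: `BitwisePoly` says that each output bit has a polynomial-size
circuit, is closed under composition, loops and families, and with a polynomial number of output bits
gives back `PolyComputable`.
-/

/-! ### Building circuits -/

namespace Circ

/-- Rewiring of the inputs of a circuit. -/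
def rename : {ι κ : Type} → Circ ι κ → {ι' : Type} → (ι → ι') → Circ ι' κ
  | _, _, out g, _, f => out (f ∘ g)
  | _, _, const b C, _, f => const b (C.rename (Option.map f))
  | _, _, gate op i j C, _, f => gate op (f i) (f j) (C.rename (Option.map f))

theorem gates_rename {ι κ : Type} (C : Circ ι κ) :
    ∀ {ι' : Type} (f : ι → ι'), (C.rename f).gates = C.gates := by
  induction C with
  | out g => intros; rfl
  | const b C ih => intro ι' f; simp [rename, gates, ih]
  | gate op i j C ih => intro ι' f; simp [rename, gates, ih]

theorem eval_rename {ι κ : Type} (C : Circ ι κ) :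
    ∀ {ι' : Type} (f : ι → ι') (x : ι' → Bool), (C.rename f).eval x = C.eval (x ∘ f) := by
  induction C with
  | out g => intros; rfl
  | const b C ih =>
    intro ι' f x
    simp only [rename, eval, ih]
    congr 1; funext a; cases a <;> rfl
  | gate op i j C ih =>
    intro ι' f x
    simp only [rename, eval, ih]
    congr 1; funext a; cases a <;> rfl

/-- Run a one-output circuit, then a second circuit that sees its output as an additional wire
`none`, next to the wires `f i` present before. -/
def graft : {ι υ : Type} → Circ ι υ → υ → {ι' κ : Type} → (ι' → ι) → Circ (Option ι') κ → Circ ι κ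
  | _, _, out g, u, _, _, f, D => D.rename (fun a => a.elim (g u) f)
  | _, _, const b C, u, _, _, f, D => const b (C.graft u (some ∘ f) D)
  | _, _, gate op i j C, u, _, _, f, D => gate op i j (C.graft u (some ∘ f) D)

theorem gates_graft {ι υ : Type} (C : Circ ι υ) (u : υ) :
    ∀ {ι' κ : Type} (f : ι' → ι) (D : Circ (Option ι') κ),
      (C.graft u f D).gates = C.gates + D.gates := by
  induction C with
  | out g => intros; simp [graft, gates, gates_rename]
  | const b C ih => intros; simp [graft, gates, ih]; omega
  | gate op i j C ih => intros; simp [graft, gates, ih]; omega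

theorem eval_graft {ι υ : Type} (C : Circ ι υ) (u : υ) :
    ∀ {ι' κ : Type} (f : ι' → ι) (D : Circ (Option ι') κ) (x : ι → Bool),
      (C.graft u f D).eval x = D.eval (fun a => a.elim (C.eval x u) (x ∘ f)) := by
  induction C with
  | out g =>
    intro ι' κ f D x
    simp only [graft, eval_rename, eval]
    congr 1; funext a; cases a <;> rfl
  | const b C ih => intro ι' κ f D x; simp only [graft, eval, ih]; rfl
  | gate op i j C ih => intro ι' κ f D x; simp only [graft, eval, ih]; rfl

end Circ

/-- `out a` is computed from the bits `inp a` by a circuit with at most `N` gates. -/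
def HasCircuit {α ι κ : Type} (N : ℕ) (inp : α → ι → Bool) (out : α → κ → Bool) : Prop :=
  ∃ C : Circ ι κ, C.gates ≤ N ∧ ∀ a, C.eval (inp a) = out a

/-- The bit `b a` is computed from the bits `inp a` by a circuit with at most `N` gates. -/
def HasBitCircuit {α ι : Type} (N : ℕ) (inp : α → ι → Bool) (b : α → Bool) : Prop :=
  HasCircuit N inp (fun a (_ : Unit) => b a)

namespace HasCircuit

variable {α ι κ : Type} {N M : ℕ} {inp : α → ι → Bool} {out : α → κ → Bool}

theorem mono (h : HasCircuit N inp out) (hNM : N ≤ M) : HasCircuit M inp out :=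
  let ⟨C, hC, he⟩ := h; ⟨C, hC.trans hNM, he⟩

theorem rename {ι' : Type} (h : HasCircuit N inp out) {inp' : α → ι' → Bool} (f : ι → ι')
    (hf : ∀ a i, inp' a (f i) = inp a i) : HasCircuit N inp' out := by
  obtain ⟨C, hC, he⟩ := h
  refine ⟨C.rename f, by rwa [Circ.gates_rename], fun a => ?_⟩
  rw [Circ.eval_rename, ← he]
  congr 1; funext i; exact hf a i

/-- Sequential composition: the bit `b` is available to the second circuit as the wire `none`. -/
theorem graft {b : α → Bool} (hb : HasBitCircuit N inp b)
    (h : HasCircuit M (fun a (o : Option ι) => o.elim (b a) (inp a)) out) :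
    HasCircuit (N + M) inp out := by
  obtain ⟨C, hC, he⟩ := hb
  obtain ⟨D, hD, hd⟩ := h
  refine ⟨C.graft () id D, by rw [Circ.gates_graft]; omega, fun a => ?_⟩
  rw [Circ.eval_graft, ← hd, he]
  rfl

theorem bit (h : HasCircuit N inp out) (o : κ) : HasBitCircuit N inp (fun a => out a o) := by
  obtain ⟨C, hC, he⟩ := h
  suffices H : ∀ {ι κ : Type} (C : Circ ι κ) (o : κ), ∃ D : Circ ι Unit,
      D.gates = C.gates ∧ ∀ x, D.eval x = fun _ => C.eval x o by
    obtain ⟨D, hD, hd⟩ := H C o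
    exact ⟨D, hD ▸ hC, fun a => by rw [hd, he]⟩
  intro ι κ C
  induction C with
  | out f => exact fun o => ⟨.out fun _ => f o, rfl, fun _ => rfl⟩
  | const b C ih =>
    intro o
    obtain ⟨D, h1, h2⟩ := ih o
    exact ⟨.const b D, by simp [Circ.gates, h1], fun x => by simp [Circ.eval, h2]⟩
  | gate op i j C ih =>
    intro o
    obtain ⟨D, h1, h2⟩ := ih o
    exact ⟨.gate op i j D, by simp [Circ.gates, h1], fun x => by simp [Circ.eval, h2]⟩

/-- Composition: each of the intermediate bits `mid a` is computed once, whatever the number of its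
uses. -/
theorem comp {μ : Type} [Fintype μ] {mid : α → μ → Bool}
    (hm : ∀ m, HasBitCircuit N inp (fun a => mid a m))
    (h : HasCircuit M (fun a => Sum.elim (inp a) (mid a)) out) :
    HasCircuit (Fintype.card μ * N + M) inp out := by
  suffices H : ∀ (μ : Type) [Fintype μ], ∀ {ι : Type} {inp : α → ι → Bool} {mid : α → μ → Bool},
      (∀ m, HasBitCircuit N inp (fun a => mid a m)) →
      HasCircuit M (fun a => Sum.elim (inp a) (mid a)) out →
      HasCircuit (Fintype.card μ * N + M) inp out from H μ hm h
  intro μ _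
  refine Fintype.induction_empty_option (P := fun μ _ => ∀ {ι : Type} {inp : α → ι → Bool}
    {mid : α → μ → Bool}, (∀ m, HasBitCircuit N inp (fun a => mid a m)) →
      HasCircuit M (fun a => Sum.elim (inp a) (mid a)) out →
      HasCircuit (Fintype.card μ * N + M) inp out) ?_ ?_ ?_ μ
  · intro μ ν _ e ih ι inp mid hm h
    let := Fintype.ofEquiv ν e.symm
    rw [← Fintype.card_congr e]
    refine ih (mid := fun a m => mid a (e m)) (fun m => hm (e m))
      (h.rename (Sum.map id e.symm) fun a i => ?_)
    cases i <;> simp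
  · intro ι inp mid _ h
    simpa using h.rename (inp' := inp) (Sum.elim id PEmpty.elim) (by rintro a (i | ⟨⟨⟩⟩); rfl)
  · intro μ _ ih ι inp mid hm h
    have := graft (hm none) (ih (mid := fun a m => mid a (some m))
      (fun m => (hm (some m)).rename some fun _ _ => rfl)
      (h.rename (Sum.elim (fun i => .inl (some i)) (fun o => o.elim (.inl none) .inr)) ?_))
    · refine this.mono ?_
      rw [Fintype.card_option]
      linarith
    · rintro a (i | _ | m) <;> rfl

theorem of_bits [Fintype κ] (h : ∀ o, HasBitCircuit N inp (fun a => out a o)) :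
    HasCircuit (Fintype.card κ * N) inp out :=
  comp h (M := 0) ⟨.out Sum.inr, le_rfl, fun _ => rfl⟩

end HasCircuit

namespace HasBitCircuit

variable {α ι : Type} {N M : ℕ} {inp : α → ι → Bool} {b : α → Bool}

theorem mono (h : HasBitCircuit N inp b) (hNM : N ≤ M) : HasBitCircuit M inp b :=
  HasCircuit.mono h hNM

theorem input (i : ι) : HasBitCircuit N inp (fun a => inp a i) :=
  ⟨.out fun _ => i, Nat.zero_le _, fun _ => rfl⟩

theorem const (c : Bool) (hN : 1 ≤ N) : HasBitCircuit N inp (fun _ => c) :=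
  ⟨.const c (.out fun _ => none), hN, fun _ => rfl⟩

theorem op (f : Bool → Bool → Bool) {b c : α → Bool} (hb : HasBitCircuit N inp b)
    (hc : HasBitCircuit M inp c) : HasBitCircuit (N + M + 1) inp (fun a => f (b a) (c a)) := by
  refine (HasCircuit.graft hb (HasCircuit.graft (M := 1)
    (HasCircuit.rename hc some fun _ _ => rfl) ?_)).mono (by omega : _ ≤ N + M + 1)
  exact ⟨.gate f (some none) none (.out fun _ => none), le_rfl, fun _ => rfl⟩

theorem not (hb : HasBitCircuit N inp b) : HasBitCircuit (N + 1) inp (fun a => !b a) := by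
  refine HasCircuit.graft hb ?_
  exact ⟨.gate (fun x _ => !x) none none (.out fun _ => none), le_rfl, fun _ => rfl⟩

theorem ite {b c d : α → Bool} (hb : HasBitCircuit N inp b) (hc : HasBitCircuit N inp c)
    (hd : HasBitCircuit N inp d) :
    HasBitCircuit (4 * N + 3) inp (fun a => if b a then c a else d a) := by
  refine HasCircuit.mono (N := (N + N + 1) + (N + N + 1) + 1) ?_ (by omega)
  have := op or (op and hb hc) (op (fun x y => !x && y) hb hd)
  have heq : (fun a => if b a then c a else d a) = fun a => (b a && c a) || (!b a && d a) := by
    funext a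
    cases b a <;> simp
  exact heq ▸ this

/-- Evaluation of a loop with `m` rounds and the state bits `st i a` after `i` rounds. -/
theorem loop {σ : Type} [Fintype σ] (st : ℕ → α → σ → Bool) (m : ℕ)
    (h0 : ∀ o, HasBitCircuit N inp (fun a => st 0 a o))
    (hs : ∀ i < m, ∀ o, HasBitCircuit N (fun a => Sum.elim (inp a) (st i a))
      (fun a => st (i + 1) a o)) (o : σ) :
    HasBitCircuit ((m + 1) * (Fintype.card σ * N)) inp (fun a => st m a o) := by
  -- In continuation form every state bit is computed only once; bounding each bit separately would
  -- multiply the cost by the number of state bits in every round.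
  suffices H : ∀ (j M : ℕ) (b : α → Bool), j ≤ m →
      HasBitCircuit M (fun a => Sum.elim (inp a) (st j a)) b →
      HasBitCircuit ((j + 1) * (Fintype.card σ * N) + M) inp b by
    exact H m 0 _ le_rfl (input (Sum.inr o))
  intro j
  induction j with
  | zero =>
    intro M b _ h
    exact HasCircuit.mono (HasCircuit.comp h0 h) (by simp)
  | succ j ih =>
    intro M b hj h
    refine (ih _ b (by omega) (HasCircuit.comp (hs j (by omega)) (HasCircuit.rename h
      (Sum.elim (fun i => .inl (.inl i)) .inr) ?_))).mono (by ring_nf; omega)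
    rintro a (i | o) <;> rfl

end HasBitCircuit

/-! ### Polynomial bounds -/

namespace PolyBounded

theorem const (c : ℕ) : PolyBounded fun _ => c := ⟨Polynomial.C c, by simp⟩

theorem mono {f g : ℕ → ℕ} (hg : PolyBounded g) (h : ∀ k, f k ≤ g k) : PolyBounded f :=
  let ⟨p, hp⟩ := hg; ⟨p, fun k => (h k).trans (hp k)⟩

theorem add {f g : ℕ → ℕ} (hf : PolyBounded f) (hg : PolyBounded g) :
    PolyBounded fun k => f k + g k := by
  obtain ⟨p, hp⟩ := hf
  obtain ⟨q, hq⟩ := hg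
  exact ⟨p + q, fun k => by simpa using Nat.add_le_add (hp k) (hq k)⟩

theorem mul {f g : ℕ → ℕ} (hf : PolyBounded f) (hg : PolyBounded g) :
    PolyBounded fun k => f k * g k := by
  obtain ⟨p, hp⟩ := hf
  obtain ⟨q, hq⟩ := hg
  exact ⟨p * q, fun k => by simpa using Nat.mul_le_mul (hp k) (hq k)⟩

end PolyBounded

/-! ### Functions all of whose output bits have polynomial-size circuits -/

/-- Every single bit of `out k a` is computed from `inp k a` by a circuit of size polynomial in `k`,
with a common polynomial. There is no bound on the number of output bits, so a family of functions
can be treated as one function, with the index of the family as a part of the index `κ k`. -/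
def BitwisePoly {α ι κ : ℕ → Type} (inp : ∀ k, α k → ι k → Bool) (out : ∀ k, α k → κ k → Bool) :
    Prop :=
  ∃ N : ℕ → ℕ, PolyBounded N ∧ ∀ k o, HasBitCircuit (N k) (inp k) (fun a => out k a o)

namespace PolyComputable

variable {α ι κ : ℕ → Type} [∀ k, Fintype (ι k)] [∀ k, Fintype (κ k)]
  {inp : ∀ k, α k → ι k → Bool} {out : ∀ k, α k → κ k → Bool}

theorem bitwise (h : PolyComputable inp out) : BitwisePoly inp out := by
  obtain ⟨p, hp⟩ := h
  refine ⟨fun k => p.eval k, ⟨p, fun _ => le_rfl⟩, fun k o => ?_⟩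
  obtain ⟨C, hC, he⟩ := hp k
  exact HasCircuit.bit ⟨C, by unfold Circ.size at hC; dsimp only; omega, he⟩ o

theorem input_bounded (h : PolyComputable inp out) : PolyBounded fun k => Fintype.card (ι k) := by
  obtain ⟨p, hp⟩ := h
  refine ⟨p, fun k => ?_⟩
  obtain ⟨C, hC, -⟩ := hp k
  unfold Circ.size at hC; dsimp only; omega

theorem output_bounded (h : PolyComputable inp out) :
    PolyBounded fun k => Fintype.card (κ k) := by
  obtain ⟨p, hp⟩ := h
  refine ⟨p, fun k => ?_⟩
  obtain ⟨C, hC, -⟩ := hp k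
  unfold Circ.size at hC; dsimp only; omega

end PolyComputable

namespace BitwisePoly

variable {α ι κ μ : ℕ → Type} {inp : ∀ k, α k → ι k → Bool}

theorem polyComputable [∀ k, Fintype (ι k)] [∀ k, Fintype (κ k)] {out : ∀ k, α k → κ k → Bool}
    (h : BitwisePoly inp out) (hι : PolyBounded fun k => Fintype.card (ι k))
    (hκ : PolyBounded fun k => Fintype.card (κ k)) : PolyComputable inp out := by
  obtain ⟨N, hN, h⟩ := h
  obtain ⟨p, hp⟩ := ((hκ.mul hN).add hι).add hκ
  refine ⟨p, fun k => ?_⟩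
  obtain ⟨C, hC, he⟩ := HasCircuit.of_bits (h k)
  refine ⟨C, le_trans ?_ (hp k), he⟩
  unfold Circ.size
  dsimp only
  omega

theorem input (r : ∀ k, κ k → ι k) : BitwisePoly inp fun k a o => inp k a (r k o) :=
  ⟨fun _ => 0, .const 0, fun k o => .input (r k o)⟩

theorem const (c : ∀ k, κ k → Bool) : BitwisePoly inp fun k _ o => c k o :=
  ⟨fun _ => 1, .const 1, fun k o => .const (c k o) le_rfl⟩

theorem reindex {out : ∀ k, α k → κ k → Bool} (h : BitwisePoly inp out) (r : ∀ k, μ k → κ k) :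
    BitwisePoly inp fun k a o => out k a (r k o) :=
  let ⟨N, hN, h⟩ := h; ⟨N, hN, fun k o => h k (r k o)⟩

theorem sumElim {f : ∀ k, α k → κ k → Bool} {g : ∀ k, α k → μ k → Bool}
    (hf : BitwisePoly inp f) (hg : BitwisePoly inp g) :
    BitwisePoly (κ := fun k => κ k ⊕ μ k) inp fun k a => Sum.elim (f k a) (g k a) := by
  obtain ⟨N, hN, hf⟩ := hf
  obtain ⟨M, hM, hg⟩ := hg
  refine ⟨fun k => N k + M k, hN.add hM, fun k o => ?_⟩
  rcases o with o | o
  · exact (hf k o).mono (Nat.le_add_right _ _)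
  · exact (hg k o).mono (Nat.le_add_left _ _)

theorem ite {c f g : ∀ k, α k → κ k → Bool} (hc : BitwisePoly inp c)
    (hf : BitwisePoly inp f) (hg : BitwisePoly inp g) :
    BitwisePoly inp fun k a o => if c k a o then f k a o else g k a o := by
  obtain ⟨K, hK, hc⟩ := hc
  obtain ⟨N, hN, hf⟩ := hf
  obtain ⟨M, hM, hg⟩ := hg
  refine ⟨fun k => 4 * (K k + N k + M k) + 3,
    ((PolyBounded.const 4).mul ((hK.add hN).add hM)).add (.const 3), fun k o => ?_⟩
  exact .ite ((hc k o).mono (by omega)) ((hf k o).mono (by omega)) ((hg k o).mono (by omega))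

theorem not {f : ∀ k, α k → κ k → Bool} (hf : BitwisePoly inp f) :
    BitwisePoly inp fun k a o => !f k a o := by
  obtain ⟨N, hN, hf⟩ := hf
  exact ⟨fun k => N k + 1, hN.add (.const 1), fun k o => (hf k o).not⟩

/-- A case distinction that does not depend on the argument, only on the output bit. -/
theorem dite {p : ∀ k, κ k → Prop} [∀ k o, Decidable (p k o)] {f g : ∀ k, α k → κ k → Bool}
    (hf : BitwisePoly inp f) (hg : BitwisePoly inp g) :
    BitwisePoly inp fun k a o => if p k o then f k a o else g k a o := by
  obtain ⟨N, hN, hf⟩ := hf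
  obtain ⟨M, hM, hg⟩ := hg
  refine ⟨fun k => N k + M k, hN.add hM, fun k o => ?_⟩
  by_cases h : p k o
  · simpa only [h, if_true] using (hf k o).mono (by omega)
  · simpa only [h, if_false] using (hg k o).mono (by omega)

/-- Application of an efficient function to the members `ψ k j a` of a family of arguments. -/
theorem apply {β ι' κ' : ℕ → Type} [∀ k, Fintype (ι' k)] [∀ k, Fintype (κ' k)]
    {inp' : ∀ k, β k → ι' k → Bool} {out' : ∀ k, β k → κ' k → Bool}
    (h : PolyComputable inp' out') {J : ℕ → Type} (ψ : ∀ k, J k → α k → β k)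
    (hψ : BitwisePoly (κ := fun k => J k × ι' k) inp fun k a p => inp' k (ψ k p.1 a) p.2) :
    BitwisePoly (κ := fun k => J k × κ' k) inp fun k a p => out' k (ψ k p.1 a) p.2 := by
  obtain ⟨N, hN, hψ⟩ := hψ
  obtain ⟨M, hM, hb⟩ := h.bitwise
  refine ⟨fun k => Fintype.card (ι' k) * N k + M k, (h.input_bounded.mul hN).add hM,
    fun k p => ?_⟩
  obtain ⟨C, hC, he⟩ := hb k p.2
  exact HasCircuit.comp (mid := fun a i => inp' k (ψ k p.1 a) i) (fun i => hψ k (p.1, i))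
    (HasCircuit.rename (inp := fun a => inp' k (ψ k p.1 a)) ⟨C, hC, fun a => he _⟩ Sum.inr
      fun _ _ => rfl)

theorem apply_one {β ι' κ' : ℕ → Type} [∀ k, Fintype (ι' k)] [∀ k, Fintype (κ' k)]
    {inp' : ∀ k, β k → ι' k → Bool} {out' : ∀ k, β k → κ' k → Bool}
    (h : PolyComputable inp' out') (ψ : ∀ k, α k → β k)
    (hψ : BitwisePoly inp fun k a => inp' k (ψ k a)) :
    BitwisePoly inp fun k a => out' k (ψ k a) :=
  (apply h (J := fun _ => Unit) (fun k _ a => ψ k a) (hψ.reindex fun _ => Prod.snd)).reindex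
    fun _ o => ((), o)

end BitwisePoly

/-! ### Circuits for modular arithmetic -/

/-- Every binary digit of the number `x a` is computed from the bits `inp a` by a circuit with at
most `N` gates. -/
def HasNatCircuit {α ι : Type} (N : ℕ) (inp : α → ι → Bool) (x : α → ℕ) : Prop :=
  ∀ i, HasBitCircuit N inp (fun a => (x a).testBit i)

/-- A bound for the cost of a bit of the sum of two `W`-bit numbers whose bits cost `N`. -/
def addCost (W N : ℕ) : ℕ := (W + 2) * (4 * N + 6)

/-- A bound for the cost of a bit of the sum of two residues of `B` bits whose bits cost `N`. -/
def modAddCost (B N : ℕ) : ℕ := 4 * addCost (B + 1) (addCost (B + 1) N) + 3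

/-- A bound for the cost of a bit of the product of two residues. -/
def modMulCost (B N : ℕ) : ℕ := (B + 1) * (B * modAddCost B (modAddCost B N)) + 1

theorem le_addCost (W N : ℕ) : 4 * N + 6 ≤ addCost W N := by
  unfold addCost; nlinarith

theorem le_modAddCost (B N : ℕ) : 4 * N + 6 ≤ modAddCost B N := by
  have := le_addCost (B + 1) N
  have := le_addCost (B + 1) (addCost (B + 1) N)
  unfold modAddCost
  omega

section Arithmetic

variable {α ι : Type} {N : ℕ} {inp : α → ι → Bool}

theorem HasNatCircuit.mono {M : ℕ} {x : α → ℕ} (hx : HasNatCircuit N inp x) (h : N ≤ M) :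
    HasNatCircuit M inp x :=
  fun i => (hx i).mono h

theorem HasNatCircuit.of_lt {B : ℕ} {x : α → ℕ} (hN : 1 ≤ N) (hlt : ∀ a, x a < 2 ^ B)
    (h : ∀ i < B, HasBitCircuit N inp (fun a => (x a).testBit i)) : HasNatCircuit N inp x := by
  intro i
  by_cases hi : i < B
  · exact h i hi
  · have : (fun a => (x a).testBit i) = fun _ => false := by
      funext a
      exact Nat.testBit_eq_false_of_lt
        ((hlt a).trans_le (Nat.pow_le_pow_right (by norm_num) (by omega)))
    exact this ▸ .const false hN

/-- The carries of an addition, computed by the ripple-carry method. -/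
theorem hasBitCircuit_carry {W : ℕ} {x y : α → BitVec W} (hN : 1 ≤ N)
    (hx : ∀ i, HasBitCircuit N inp (fun a => (x a).getLsbD i))
    (hy : ∀ i, HasBitCircuit N inp (fun a => (y a).getLsbD i)) (c : Bool) (i : ℕ) :
    HasBitCircuit ((i + 1) * (4 * N + 6)) inp (fun a => BitVec.carry i (x a) (y a) c) := by
  have := HasBitCircuit.loop (N := 4 * N + 6) (inp := inp)
    (fun i a (_ : Unit) => BitVec.carry i (x a) (y a) c) i
    (fun _ => by simpa only [BitVec.carry_zero] using .const c (by omega)) ?_ ()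
  · simpa using this
  · intro j _ _
    have hx' : HasBitCircuit N (fun a => Sum.elim (inp a)
        (fun _ : Unit => BitVec.carry j (x a) (y a) c)) (fun a => (x a).getLsbD j) :=
      HasCircuit.rename (hx j) Sum.inl fun _ _ => rfl
    have hy' : HasBitCircuit N (fun a => Sum.elim (inp a)
        (fun _ : Unit => BitVec.carry j (x a) (y a) c)) (fun a => (y a).getLsbD j) :=
      HasCircuit.rename (hy j) Sum.inl fun _ _ => rfl
    have hc : HasBitCircuit 0 (fun a => Sum.elim (inp a)
        (fun _ : Unit => BitVec.carry j (x a) (y a) c))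
        (fun a => BitVec.carry j (x a) (y a) c) := .input (Sum.inr ())
    simp only [BitVec.carry_succ, Bool.atLeastTwo]
    exact (((hx'.op and hy').op or (hx'.op and hc)).op or (hy'.op and hc)).mono (by omega)

/-- Addition with carry, which with `c = true` and a complemented argument is subtraction. -/
theorem hasBitCircuit_adc {W : ℕ} {x y : α → BitVec W} (hN : 1 ≤ N)
    (hx : ∀ i, HasBitCircuit N inp (fun a => (x a).getLsbD i))
    (hy : ∀ i, HasBitCircuit N inp (fun a => (y a).getLsbD i)) (c : Bool) (i : ℕ) :
    HasBitCircuit (addCost W N) inp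
      (fun a => (x a + y a + BitVec.setWidth W (BitVec.ofBool c)).getLsbD i) := by
  by_cases hi : i < W
  · simp only [BitVec.getLsbD_add_add_bool hi]
    refine ((hx i).op xor ((hy i).op xor (hasBitCircuit_carry hN hx hy c i))).mono ?_
    unfold addCost
    have : (i + 1) * (4 * N + 6) ≤ W * (4 * N + 6) := Nat.mul_le_mul_right _ hi
    nlinarith
  · have : (fun a => (x a + y a + BitVec.setWidth W (BitVec.ofBool c)).getLsbD i)
        = fun _ => false := by
      funext a
      exact BitVec.getLsbD_of_ge _ _ (by omega)
    exact this ▸ .const false ((by omega : 1 ≤ 4 * N + 6).trans (le_addCost W N))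

/-- Modular addition: `q` is subtracted from the sum if the sum is not smaller than `q`. -/
theorem HasNatCircuit.modAdd {B : ℕ} {x y q : α → ℕ} (hN : 1 ≤ N) (hx : HasNatCircuit N inp x)
    (hy : HasNatCircuit N inp y) (hq : HasNatCircuit N inp q) (hxq : ∀ a, x a < q a)
    (hyq : ∀ a, y a < q a) (hqB : ∀ a, q a < 2 ^ B) :
    HasNatCircuit (modAddCost B N) inp (fun a => (x a + y a) % q a) := by
  have ofNat {M : ℕ} {z : α → ℕ} (hM : 1 ≤ M) (hz : HasNatCircuit M inp z) (i : ℕ) :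
      HasBitCircuit M inp (fun a => (BitVec.ofNat (B + 1) (z a)).getLsbD i) := by
    simp only [BitVec.getLsbD_ofNat]
    by_cases hi : i < B + 1
    · simpa only [hi, decide_true, Bool.true_and] using hz i
    · simpa only [hi, decide_false, Bool.false_and] using .const false hM
  let S := fun a => BitVec.ofNat (B + 1) (x a) + BitVec.ofNat (B + 1) (y a)
  let Q := fun a => BitVec.ofNat (B + 1) (q a)
  let A := addCost (B + 1) N
  have hA : 4 * N + 6 ≤ A := le_addCost _ _
  have hS (i : ℕ) : HasBitCircuit A inp (fun a => (S a).getLsbD i) := by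
    simpa [S, BitVec.ofBool] using hasBitCircuit_adc hN (ofNat hN hx) (ofNat hN hy) false i
  have hQ (i : ℕ) : HasBitCircuit A inp (fun a => (~~~Q a).getLsbD i) := by
    simp only [BitVec.getLsbD_not]
    by_cases hi : i < B + 1
    · simpa only [hi, decide_true, Bool.true_and] using (ofNat hN hq i).not.mono (by omega)
    · simpa only [hi, decide_false, Bool.false_and] using .const false (by omega)
  have hD (i : ℕ) : HasBitCircuit (addCost (B + 1) A) inp (fun a => (S a - Q a).getLsbD i) := by
    have (a : α) : S a - Q a
        = S a + ~~~Q a + BitVec.setWidth (B + 1) (BitVec.ofBool true) := by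
      rw [BitVec.sub_eq_add_neg, BitVec.neg_eq_not_add, ← BitVec.add_assoc]
      congr 1
      apply BitVec.eq_of_toNat_eq
      simp [BitVec.ofBool]
    simp only [this]
    exact hasBitCircuit_adc (by omega) hS hQ true i
  have hult : HasBitCircuit (addCost (B + 1) A) inp (fun a => (S a).ult (Q a)) := by
    simp only [BitVec.ult_eq_not_carry]
    refine (hasBitCircuit_carry (by omega) hS hQ true (B + 1)).not.mono ?_
    unfold addCost
    nlinarith
  intro i
  have hres (a : α) : ((x a + y a) % q a).testBit i
      = if (S a).ult (Q a) then (S a).getLsbD i else (S a - Q a).getLsbD i := by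
    have h1 := hxq a
    have h2 := hyq a
    have h3 := hqB a
    have h4 : 2 ^ (B + 1) = 2 * 2 ^ B := by ring
    have hSn : (S a).toNat = x a + y a := by
      simp only [S, BitVec.toNat_add, BitVec.toNat_ofNat]
      rw [Nat.mod_eq_of_lt (by omega : x a < 2 ^ (B + 1)),
        Nat.mod_eq_of_lt (by omega : y a < 2 ^ (B + 1)), Nat.mod_eq_of_lt (by omega)]
    have hQn : (Q a).toNat = q a := by
      simp only [Q, BitVec.toNat_ofNat]
      exact Nat.mod_eq_of_lt (by omega)
    have hu : (S a).ult (Q a) = decide (x a + y a < q a) := by rw [BitVec.ult, hSn, hQn]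
    rw [hu]
    by_cases h : x a + y a < q a
    · simp [h, BitVec.getLsbD, hSn, Nat.mod_eq_of_lt h]
    · have hd : (S a - Q a).toNat = x a + y a - q a := by
        rw [BitVec.toNat_sub_of_le (by rw [BitVec.le_def]; omega), hSn, hQn]
      simp only [h, decide_false, BitVec.getLsbD, hd, Bool.false_eq_true, if_false]
      rw [Nat.mod_eq_sub_mod (by omega), Nat.mod_eq_of_lt (by omega)]
  simp only [hres]
  refine (hult.ite ((hS i).mono ?_) (hD i)).mono le_rfl
  have := le_addCost (B + 1) A
  omega

/-- A loop whose state is a number of `B` bits, initially zero. A round is given by a circuit that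
sees, besides the wires `inp`, the bits of the state as wires (so at the cost of at most one gate, for
the zero bits beyond `B`). -/
theorem HasNatCircuit.loop {B : ℕ} (st : ℕ → α → ℕ) (m : ℕ) (hN : 1 ≤ N)
    (hB : ∀ i a, st i a < 2 ^ B) (h0 : ∀ a, st 0 a = 0)
    (hs : ∀ (i : ℕ), i < m → ∀ {υ : Type} (inp' : α → υ → Bool)
      (f : ι → υ), (∀ a i, inp' a (f i) = inp a i) → HasNatCircuit 1 inp' (st i) →
      HasNatCircuit N inp' (st (i + 1))) :
    HasNatCircuit ((m + 1) * (B * N) + 1) inp (st m) := by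
  refine .of_lt (by omega) (fun a => hB m a) fun i hi => ?_
  have := HasBitCircuit.loop (N := N) (inp := inp) (fun i a (o : Fin B) => (st i a).testBit o) m
    (fun o => by simpa only [h0, Nat.zero_testBit] using .const false hN)
    (fun i hi o => hs i hi _ Sum.inl (fun _ _ => rfl)
      (.of_lt le_rfl (fun a => hB i a) fun j hj => .input (Sum.inr (⟨j, hj⟩ : Fin B))) o)
    ⟨i, hi⟩
  rw [Fintype.card_fin] at this
  exact this.mono (by omega)

/-- Modular multiplication by double-and-add. -/
theorem HasNatCircuit.modMul {B : ℕ} {z w q : α → ℕ} (hN : 1 ≤ N) (hz : HasNatCircuit N inp z)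
    (hw : HasNatCircuit N inp w) (hq : HasNatCircuit N inp q) (hzq : ∀ a, z a < q a)
    (hwq : ∀ a, w a < q a) (hqB : ∀ a, q a < 2 ^ B) :
    HasNatCircuit (modMulCost B N) inp (fun a => (z a * w a) % q a) := by
  have hA := le_modAddCost B N
  have hq0 (a : α) : 0 < q a := (Nat.zero_le _).trans_lt (hwq a)
  have := HasNatCircuit.loop (N := modAddCost B (modAddCost B N)) (B := B) (inp := inp)
    (fun t a => (z a / 2 ^ (B - t)) * w a % q a) B
    (by have := le_modAddCost B (modAddCost B N); omega)
    (fun t a => (Nat.mod_lt _ (hq0 a)).trans (hqB a))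
    (fun a => by simp [Nat.div_eq_of_lt ((hzq a).trans (hqB a))]) ?_
  · simpa [modMulCost] using this
  · intro t ht υ inp' f hf hst
    have up {x : α → ℕ} (hx : HasNatCircuit N inp x) : HasNatCircuit N inp' x :=
      fun i => HasCircuit.rename (hx i) f hf
    have hdbl := HasNatCircuit.modAdd hN (hst.mono hN) (hst.mono hN) (up hq)
      (fun a => Nat.mod_lt _ (hq0 a)) (fun a => Nat.mod_lt _ (hq0 a)) hqB
    have hadd : HasNatCircuit (modAddCost B N) inp'
        (fun a => if (z a).testBit (B - t - 1) then w a else 0) := by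
      intro i
      have : (fun a => (if (z a).testBit (B - t - 1) then w a else 0).testBit i)
          = fun a => if (z a).testBit (B - t - 1) then (w a).testBit i else false := by
        funext a
        split <;> simp
      rw [this]
      exact ((up hz _).ite (up hw i) (.const false hN)).mono (by omega)
    have := HasNatCircuit.modAdd (by omega) hdbl hadd ((up hq).mono (by omega))
      (fun a => Nat.mod_lt _ (hq0 a))
      (fun a => by
        split
        · exact hwq a
        · exact hq0 a) hqB
    have heq : (fun a => z a / 2 ^ (B - (t + 1)) * w a % q a) = fun a =>
        ((z a / 2 ^ (B - t) * w a % q a + z a / 2 ^ (B - t) * w a % q a) % q a +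
          if (z a).testBit (B - t - 1) then w a else 0) % q a := by
      funext a
      -- Each round takes one more binary digit of `z` into account.
      have hbit : z a / 2 ^ (B - (t + 1))
          = 2 * (z a / 2 ^ (B - t)) + ((z a).testBit (B - t - 1)).toNat := by
        rw [Nat.toNat_testBit, show B - t = (B - t - 1) + 1 by omega, pow_succ,
          ← Nat.div_div_eq_div_mul]
        simp only [Nat.add_sub_cancel, show B - (t + 1) = B - t - 1 by omega]
        omega
      have hsum : z a / 2 ^ (B - (t + 1)) * w a
          = (z a / 2 ^ (B - t) * w a + z a / 2 ^ (B - t) * w a) +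
            if (z a).testBit (B - t - 1) then w a else 0 := by
        rw [hbit]
        cases (z a).testBit (B - t - 1) <;> simp <;> ring
      rw [hsum]
      simp [Nat.add_mod]
    rw [heq]
    exact this

/-- The modular inner product of `z₀ + z₁` and `w`. -/
theorem HasNatCircuit.modDot {B d : ℕ} {z₀ z₁ w : ℕ → α → ℕ} {q : α → ℕ} (hN : 1 ≤ N)
    (hz₀ : ∀ j < d, HasNatCircuit N inp (z₀ j)) (hz₁ : ∀ j < d, HasNatCircuit N inp (z₁ j))
    (hw : ∀ j < d, HasNatCircuit N inp (w j)) (hq : HasNatCircuit N inp q)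
    (hz₀q : ∀ j < d, ∀ a, z₀ j a < q a) (hz₁q : ∀ j < d, ∀ a, z₁ j a < q a)
    (hwq : ∀ j < d, ∀ a, w j a < q a) (hq0 : ∀ a, 0 < q a) (hqB : ∀ a, q a < 2 ^ B) :
    HasNatCircuit
      ((d + 1) * (B * modAddCost B (modMulCost B (modAddCost B N) + modAddCost B N)) + 1) inp
      (fun a => (∑ j ∈ Finset.range d, (z₀ j a + z₁ j a) * w j a) % q a) := by
  have hA := le_modAddCost B N
  set K := modMulCost B (modAddCost B N) + modAddCost B N with hK
  refine HasNatCircuit.loop (fun t a => (∑ j ∈ Finset.range t, (z₀ j a + z₁ j a) * w j a) % q a) d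
    (by have := le_modAddCost B K; omega)
    (fun t a => (Nat.mod_lt _ (hq0 a)).trans (hqB a)) (fun a => by simp) ?_
  intro t ht υ inp' f hf hst
  have up {x : α → ℕ} (hx : HasNatCircuit N inp x) : HasNatCircuit N inp' x :=
    fun i => HasCircuit.rename (hx i) f hf
  have hz := HasNatCircuit.modAdd hN (up (hz₀ t ht)) (up (hz₁ t ht)) (up hq) (hz₀q t ht)
    (hz₁q t ht) hqB
  have hm := HasNatCircuit.modMul (by omega) hz ((up (hw t ht)).mono (by omega))
    ((up hq).mono (by omega)) (fun a => Nat.mod_lt _ (hq0 a)) (hwq t ht) hqB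
  have := HasNatCircuit.modAdd (N := K) (by omega) (hst.mono (by omega)) (hm.mono (by omega))
    ((up hq).mono (by omega)) (fun a => Nat.mod_lt _ (hq0 a)) (fun a => Nat.mod_lt _ (hq0 a)) hqB
  simpa [Finset.sum_range_succ, Nat.add_mod, Nat.mul_mod] using this

end Arithmetic

/-- The matrix-vector product `(Z₀ + Z₁) w` over `ℤ/q` is efficiently computable. -/
theorem BitwisePoly.mulVec {α ι : ℕ → Type} {inp : ∀ k, α k → ι k → Bool} {n d B : ℕ → ℕ}
    (hd : PolyBounded d) (hB : PolyBounded B) (q : ∀ k, α k → Modulus (B k))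
    (Z₀ Z₁ : ∀ k a, Matrix (Fin (n k)) (Fin (d k)) (ZMod (q k a)))
    (w : ∀ k a, Fin (d k) → ZMod (q k a))
    (hq : BitwisePoly inp fun k a => natBits (B k) (q k a))
    (hZ₀ : BitwisePoly inp fun k a => matBits (B k) (Z₀ k a))
    (hZ₁ : BitwisePoly inp fun k a => matBits (B k) (Z₁ k a))
    (hw : BitwisePoly inp fun k a => resBits (B k) (w k a)) :
    BitwisePoly inp fun k a => resBits (B k) ((Z₀ k a + Z₁ k a).mulVec (w k a)) := by
  obtain ⟨N₁, hN₁, hq⟩ := hq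
  obtain ⟨N₂, hN₂, hZ₀⟩ := hZ₀
  obtain ⟨N₃, hN₃, hZ₁⟩ := hZ₁
  obtain ⟨N₄, hN₄, hw⟩ := hw
  have hN : PolyBounded fun k => N₁ k + N₂ k + N₃ k + N₄ k + 1 :=
    (((hN₁.add hN₂).add hN₃).add hN₄).add (.const 1)
  have hA {N : ℕ → ℕ} (hN : PolyBounded N) : PolyBounded fun k => addCost (B k + 1) (N k) :=
    (((hB.add (.const 1)).add (.const 2)).mul (((PolyBounded.const 4).mul hN).add (.const 6)))
  have hMA {N : ℕ → ℕ} (hN : PolyBounded N) : PolyBounded fun k => modAddCost (B k) (N k) :=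
    ((PolyBounded.const 4).mul (hA (hA hN))).add (.const 3)
  have hMM {N : ℕ → ℕ} (hN : PolyBounded N) : PolyBounded fun k => modMulCost (B k) (N k) :=
    ((hB.add (.const 1)).mul (hB.mul (hMA (hMA hN)))).add (.const 1)
  refine ⟨_, ((hd.add (.const 1)).mul (hB.mul (hMA ((hMM (hMA hN)).add (hMA hN))))).add
    (.const 1), ?_⟩
  rintro k ⟨i, l⟩
  have nat {x : α k → ℕ} {M : ℕ} (hM : M ≤ N₁ k + N₂ k + N₃ k + N₄ k) (hx : ∀ a, x a < 2 ^ B k)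
      (h : ∀ l : Fin (B k), HasBitCircuit M (inp k) (fun a => (x a).testBit l)) :
      HasNatCircuit (N₁ k + N₂ k + N₃ k + N₄ k + 1) (inp k) x :=
    .of_lt (by omega) hx fun j hj => (h ⟨j, hj⟩).mono (by omega)
  have hlt (a : α k) (x : ZMod (q k a)) : x.val < 2 ^ B k := x.val_lt.trans (q k a).2.2
  have := HasNatCircuit.modDot (B := B k) (d := d k) (inp := inp k)
    (N := N₁ k + N₂ k + N₃ k + N₄ k + 1)
    (z₀ := fun j a => if h : j < d k then (Z₀ k a i ⟨j, h⟩).val else 0)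
    (z₁ := fun j a => if h : j < d k then (Z₁ k a i ⟨j, h⟩).val else 0)
    (w := fun j a => if h : j < d k then (w k a ⟨j, h⟩).val else 0)
    (q := fun a => q k a) (by omega)
    (fun j hj => by
      simp only [hj, dif_pos]
      exact nat (M := N₂ k) (by omega) (fun a => hlt a _) fun l => hZ₀ k ((i, ⟨j, hj⟩), l))
    (fun j hj => by
      simp only [hj, dif_pos]
      exact nat (M := N₃ k) (by omega) (fun a => hlt a _) fun l => hZ₁ k ((i, ⟨j, hj⟩), l))
    (fun j hj => by
      simp only [hj, dif_pos]
      exact nat (M := N₄ k) (by omega) (fun a => hlt a _) fun l => hw k (⟨j, hj⟩, l))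
    (nat (M := N₁ k) (by omega) (fun a => (q k a).2.2) fun l => hq k l)
    (fun j hj a => by simpa only [hj, dif_pos] using ZMod.val_lt _)
    (fun j hj a => by simpa only [hj, dif_pos] using ZMod.val_lt _)
    (fun j hj a => by simpa only [hj, dif_pos] using ZMod.val_lt _)
    (fun a => (q k a).2.1) (fun a => (q k a).2.2) l
  convert this using 2 with a
  change (((Z₀ k a + Z₁ k a).mulVec (w k a) i).val).testBit _ = _
  congr 1
  beta_reduce
  rw [← ZMod.val_natCast, Finset.sum_range]
  congr 1
  simp [Matrix.mulVec, dotProduct]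

/-! ### Acceptance probabilities as averages -/

open scoped BigOperators

/-- The number `1` for `true` and `0` for `false`. -/
def indic (b : Bool) : ℝ := if b then 1 else 0

theorem indic_nonneg (b : Bool) : 0 ≤ indic b := by unfold indic; split <;> norm_num

theorem indic_le_one (b : Bool) : indic b ≤ 1 := by unfold indic; split <;> norm_num

namespace PMF

theorem toReal_pure_true (b : Bool) : ((PMF.pure b) true).toReal = indic b := by
  cases b <;> simp [indic]

theorem toReal_unif_bind {Ω : Type} [Fintype Ω] [Nonempty Ω] {α : Type} (f : Ω → PMF α) (b : α) :
    (((unif Ω).bind f) b).toReal = 𝔼 ω, (f ω b).toReal := by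
  rw [PMF.bind_apply, tsum_fintype, ENNReal.toReal_sum
    (fun ω _ => ENNReal.mul_ne_top (PMF.apply_ne_top _ _) (PMF.apply_ne_top _ _)),
    Fintype.expect_eq_sum_div_card, Finset.sum_div]
  refine Finset.sum_congr rfl fun ω _ => ?_
  rw [ENNReal.toReal_mul, PMF.uniformOfFintype_apply, ENNReal.toReal_inv, ENNReal.toReal_natCast]
  ring

theorem unif_map_equiv {Ω Ω' : Type} [Fintype Ω] [Nonempty Ω] [Fintype Ω'] [Nonempty Ω']
    (e : Ω ≃ Ω') : (unif Ω).map e = unif Ω' := by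
  ext y
  rw [PMF.map_apply, tsum_eq_single (e.symm y)]
  · simp [Fintype.card_congr e]
  · intro x hx
    rw [if_neg]
    rintro rfl
    simp at hx

end PMF

theorem toReal_unif_map_bind {Ω α : Type} [Fintype Ω] [Nonempty Ω] (X : Ω → α) (f : α → PMF Bool) :
    ((((unif Ω).map X).bind f) true).toReal = 𝔼 ω, (f (X ω) true).toReal := by
  rw [PMF.bind_map, PMF.toReal_unif_bind]
  rfl

theorem PPT.toReal_bit {ι : ℕ → Type} [∀ k, Fintype (ι k)] (D : Distinguisher ι) (k : ℕ)
    (x : ι k → Bool) : (D.bit k x true).toReal = 𝔼 z, indic (D.run k x z ()) := by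
  rw [PPT.bit, PPT.dist, PMF.map_comp, ← PMF.bind_pure_comp, PMF.toReal_unif_bind]
  exact Finset.expect_congr rfl fun z _ => PMF.toReal_pure_true _

section Expect

variable {Ω Ω' : Type} [Fintype Ω] [Fintype Ω']

theorem expect_prod (f : Ω × Ω' → ℝ) : 𝔼 p, f p = 𝔼 a, 𝔼 b, f (a, b) := by
  rw [← Finset.univ_product_univ, Finset.expect_product]

theorem abs_expect_sub_expect_le [Nonempty Ω] {f g : Ω → ℝ} {M : ℝ} (h : ∀ ω, |f ω - g ω| ≤ M) :
    |𝔼 ω, f ω - 𝔼 ω, g ω| ≤ M := by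
  rw [← Finset.expect_sub_distrib]
  exact (Finset.abs_expect_le _ _).trans (Finset.expect_le Finset.univ_nonempty fun ω _ => h ω)

/-- Resampling one coordinate of a uniformly random family. -/
theorem expect_update {ι R : Type} [Fintype ι] [DecidableEq ι] [Fintype R] [Nonempty R] (j : ι)
    (f : (ι → R) → ℝ) : 𝔼 r, f r = 𝔼 r : ι → R, 𝔼 r', f (Function.update r j r') := by
  rw [← expect_prod fun p : (ι → R) × R => f (Function.update p.1 j p.2)]
  -- Exchanging the coordinate `j` with the new value is an involution.
  let e : (ι → R) × R ≃ (ι → R) × R :=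
    Function.Involutive.toPerm (fun p => (Function.update p.1 j p.2, p.1 j))
      (fun p => by simp)
  rw [Fintype.expect_equiv e (fun p => f (Function.update p.1 j p.2)) (fun p => f p.1)
    fun _ => rfl, expect_prod]
  simp

end Expect

theorem abs_expect_sub_le_statDist {R α : Type} [Fintype R] [Nonempty R] [Fintype α]
    (X Y : R → α) {f : α → ℝ} (h0 : ∀ x, 0 ≤ f x) (h1 : ∀ x, f x ≤ 1) :
    |𝔼 r, f (X r) - 𝔼 r, f (Y r)| ≤ 2 * statDist ((unif R).map X) ((unif R).map Y) := by
  classical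
  have key (X : R → α) : 𝔼 r, f (X r) = ∑ x, (((unif R).map X) x).toReal * f x := by
    have (x : α) : (((unif R).map X) x).toReal = 𝔼 r, if X r = x then (1 : ℝ) else 0 := by
      rw [← PMF.bind_pure_comp, PMF.toReal_unif_bind]
      refine Finset.expect_congr rfl fun r _ => ?_
      by_cases hx : X r = x
      · simp [hx]
      · simp [hx, Ne.symm hx]
    simp_rw [this, Finset.expect_mul, ← Finset.expect_sum_comm]
    simp
  rw [key, key, ← Finset.sum_sub_distrib, statDist, ← mul_assoc,
    mul_one_div_cancel two_ne_zero, one_mul]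
  refine le_trans (Finset.abs_sum_le_sum_abs _ _) (Finset.sum_le_sum fun x _ => ?_)
  rw [← sub_mul, abs_mul, abs_of_nonneg (h0 x)]
  exact mul_le_of_le_one_right (abs_nonneg _) (h1 x)

/-- Replacing independent random variables `X i (e i)` by statistically close ones. -/
theorem abs_expect_pi_sub_le {R α : Type} [Fintype R] [Nonempty R] [Fintype α] {ε : ℝ} :
    ∀ {n : ℕ} (X Y : Fin n → R → α)
      (_ : ∀ i, statDist ((unif R).map (X i)) ((unif R).map (Y i)) ≤ ε) {f : (Fin n → α) → ℝ}
      (_ : ∀ x, 0 ≤ f x) (_ : ∀ x, f x ≤ 1),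
      |𝔼 e : Fin n → R, f (fun i => X i (e i)) - 𝔼 e : Fin n → R, f (fun i => Y i (e i))|
        ≤ n * (2 * ε) := by
  intro n
  induction n with
  | zero =>
    intro X Y _ f _ _
    have : (fun e : Fin 0 → R => f fun i => X i (e i)) = fun e => f fun i => Y i (e i) := by
      funext e; congr 1; funext i; exact i.elim0
    rw [this, sub_self, abs_zero, Nat.cast_zero, zero_mul]
  | succ n ih =>
    intro X Y h f h0 h1
    have split (X : Fin (n + 1) → R → α) : 𝔼 e : Fin (n + 1) → R, f (fun i => X i (e i))
        = 𝔼 a : R, 𝔼 e : Fin n → R, f (Fin.cons (X 0 a) fun i => X i.succ (e i)) := by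
      rw [← expect_prod fun p : R × (Fin n → R) => f (Fin.cons (X 0 p.1) fun i => X i.succ (p.2 i))]
      refine (Fintype.expect_equiv (Fin.consEquiv fun _ => R) _ _ fun p => ?_).symm
      congr 1
      funext i
      refine Fin.cases ?_ (fun i => ?_) i <;> simp [Fin.consEquiv]
    have s1 : |𝔼 a : R, 𝔼 e : Fin n → R, f (Fin.cons (X 0 a) fun i => X i.succ (e i))
        - 𝔼 a : R, 𝔼 e : Fin n → R, f (Fin.cons (X 0 a) fun i => Y i.succ (e i))|
        ≤ n * (2 * ε) :=
      abs_expect_sub_expect_le fun a => ih (fun i => X i.succ) (fun i => Y i.succ)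
        (fun i => h i.succ) (f := fun v => f (Fin.cons (X 0 a) v)) (fun _ => h0 _) fun _ => h1 _
    have s2 : |𝔼 a : R, 𝔼 e : Fin n → R, f (Fin.cons (X 0 a) fun i => Y i.succ (e i))
        - 𝔼 a : R, 𝔼 e : Fin n → R, f (Fin.cons (Y 0 a) fun i => Y i.succ (e i))| ≤ 2 * ε := by
      have comm (V : R → α) :
          𝔼 a : R, 𝔼 e : Fin n → R, f (Fin.cons (V a) fun i => Y i.succ (e i))
            = 𝔼 e : Fin n → R, 𝔼 a : R, f (Fin.cons (V a) fun i => Y i.succ (e i)) :=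
        Finset.expect_comm _ _ _
      rw [comm, comm]
      refine abs_expect_sub_expect_le fun e => ?_
      refine (abs_expect_sub_le_statDist (X 0) (Y 0)
        (f := fun x => f (Fin.cons x fun i => Y i.succ (e i))) (fun _ => h0 _)
        fun _ => h1 _).trans ?_
      linarith [h 0]
    rw [split, split]
    refine (abs_sub_le _ _ _).trans ((add_le_add s1 s2).trans (le_of_eq ?_))
    push_cast
    ring

/-! ### Negligible functions and the choice of the best coins -/

namespace Negligible

theorem add {f g : ℕ → ℝ} (hf : Negligible f) (hg : Negligible g) :
    Negligible fun k => f k + g k :=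
  Asymptotics.SuperpolynomialDecay.add hf hg

theorem of_abs_le {f g : ℕ → ℝ} (hg : Negligible g) (h : ∀ k, |f k| ≤ |g k|) : Negligible f :=
  Asymptotics.SuperpolynomialDecay.trans_abs_le hg h

theorem mul_polyBounded {f : ℕ → ℝ} {n : ℕ → ℕ} (hf : Negligible f) (hn : PolyBounded n) :
    Negligible fun k => n k * f k := by
  obtain ⟨p, hp⟩ := hn
  have := Asymptotics.SuperpolynomialDecay.polynomial_mul hf (p.map (Nat.castRingHom ℝ))
  refine of_abs_le this fun k => ?_
  rw [abs_mul, abs_mul]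
  refine mul_le_mul_of_nonneg_right ?_ (abs_nonneg _)
  have hk : (p.map (Nat.castRingHom ℝ)).eval (k : ℝ) = (p.eval k : ℕ) := by
    simp
  rw [hk, Nat.abs_cast, Nat.abs_cast]
  exact_mod_cast hp k

/-- Non-uniform reductions may use the best choice of a parameter: if the gap `Δ k (c k)` is
negligible for every choice of parameters `c k`, one for each `k`, it is at most a negligible
function uniformly in the parameter. -/
theorem exists_bound {Ω : ℕ → Type} [∀ k, Finite (Ω k)] [∀ k, Nonempty (Ω k)]
    (Δ : ∀ k, Ω k → ℝ) (h : ∀ c : ∀ k, Ω k, Negligible fun k => Δ k (c k)) :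
    ∃ ε : ℕ → ℝ, Negligible ε ∧ ∀ k c, Δ k c ≤ ε k := by
  choose c hc using fun k => Finite.exists_max (Δ k)
  exact ⟨_, h c, hc⟩

end Negligible

/-! ### From efficient functions to algorithms -/

/-- An efficiently computable function of an argument and of coins in `Ω k`, given by bits through
`e k`, is computed by a probabilistic polynomial-time algorithm. On bit strings which are not the
encoding `inp k a` of an argument, the algorithm evaluates the same circuits. -/
theorem exists_PPT {α ι κ ρ Ω : ℕ → Type} [∀ k, Fintype (ι k)] [∀ k, Fintype (κ k)]
    [∀ k, Fintype (ρ k)] [∀ k, Fintype (Ω k)] [∀ k, Nonempty (Ω k)] (inp : ∀ k, α k → ι k → Bool)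
    (e : ∀ k, Ω k ≃ (ρ k → Bool)) (f : ∀ k, α k → Ω k → κ k → Bool)
    (h : PolyComputable (α := fun k => α k × Ω k) (fun k a => Sum.elim (inp k a.1) (e k a.2))
      (fun k a => f k a.1 a.2)) :
    ∃ D : PPT ι κ, ∀ k a, D.dist k (inp k a) = (unif (Ω k)).map (f k a) := by
  obtain ⟨p, hp⟩ := h
  choose C hC he using hp
  let v (k : ℕ) : (ρ k → Bool) ≃ Bits (Fintype.card (ρ k)) :=
    Equiv.arrowCongr (Fintype.equivFin (ρ k)) (Equiv.refl Bool)
  refine ⟨⟨fun k => Fintype.card (ρ k), fun k x r => (C k).eval (Sum.elim x ((v k).symm r)),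
    p, fun k => ⟨(C k).rename (Sum.map id (Fintype.equivFin (ρ k))), ?_, fun a => ?_⟩⟩,
    fun k a => ?_⟩
  · have := hC k
    simp only [Circ.size, Circ.gates_rename, Fintype.card_sum, Fintype.card_fin] at this ⊢
    exact this
  · rw [Circ.eval_rename]
    congr 1
    funext i
    rcases i with i | i <;> rfl
  · rw [PPT.dist, ← PMF.unif_map_equiv ((e k).trans (v k)), PMF.map_comp]
    congr 1
    funext ω
    simpa using he k (a, ω)

/-- Deterministic efficient tests are distinguishers. -/
theorem exists_distinguisher {α ι : ℕ → Type} [∀ k, Fintype (ι k)] (inp : ∀ k, α k → ι k → Bool)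
    (b : ∀ k, α k → Bool) (h : BitwisePoly inp (fun k a (_ : Unit) => b k a))
    (hι : PolyBounded fun k => Fintype.card (ι k)) :
    ∃ D : Distinguisher ι, ∀ k a, (D.bit k (inp k a) true).toReal = indic (b k a) := by
  obtain ⟨D, hD⟩ := exists_PPT (κ := fun _ => Unit) (ρ := fun _ => Empty) (Ω := fun _ => Unit) inp
    (fun _ => Equiv.ofUnique _ _) (fun k a _ _ => b k a)
    (BitwisePoly.polyComputable (by
        obtain ⟨N, hN, h⟩ := h
        exact ⟨N, hN, fun k o => (HasCircuit.rename (inp := fun a : _ × Unit => inp k a.1)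
          (let ⟨C, hC, he⟩ := h k o; ⟨C, hC, fun a => he a.1⟩) Sum.inl fun _ _ => rfl)⟩)
      (by simpa using hι) (by simpa using .const 1))
  refine ⟨D, fun k a => ?_⟩
  rw [PPT.bit, hD, PMF.map_comp, ← PMF.bind_pure_comp, PMF.toReal_unif_bind]
  exact (Finset.expect_congr rfl fun _ _ => PMF.toReal_pure_true _).trans (Fintype.expect_const _)

/-! ### Correctness of the protocol -/

namespace AHE

variable (E : AHE) (k : ℕ) (g : Bits (E.genCoins k))

/-- Double-and-add on an encryption of `m` gives an encryption of a multiple of `m`. -/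
theorem smul_enc (m : ZMod (E.modulus k (E.gen k g).1)) (r : Bits (E.encCoins k)) :
    ∀ t z : ℕ, ∃ r', E.smul k (E.gen k g).1 t z (E.enc k (E.gen k g).1 m r)
      = E.enc k (E.gen k g).1 ((z % 2 ^ t : ℕ) * m) r' := by
  intro t
  induction t with
  | zero => exact fun z => ⟨fun _ => false, by simp [smul, encZero, Nat.mod_one]⟩
  | succ t ih =>
    intro z
    obtain ⟨r₁, h₁⟩ := ih (z / 2)
    obtain ⟨r₂, h₂⟩ := E.add_enc k g ((z / 2 % 2 ^ t : ℕ) * m) ((z / 2 % 2 ^ t : ℕ) * m) r₁ r₁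
    have hz : z % 2 ^ (t + 1) = z % 2 + 2 * (z / 2 % 2 ^ t) := by rw [pow_succ', Nat.mod_mul]
    rw [smul, h₁, h₂, hz]
    rcases Nat.mod_two_eq_zero_or_one z with h | h
    · refine ⟨r₂, ?_⟩
      rw [h]
      simp only [zero_ne_one, if_false]
      congr 1
      push_cast
      ring
    · obtain ⟨r₃, h₃⟩ := E.add_enc k g
        ((z / 2 % 2 ^ t : ℕ) * m + (z / 2 % 2 ^ t : ℕ) * m) m r₂ r
      refine ⟨r₃, ?_⟩
      rw [h, if_pos rfl, h₃]
      congr 1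
      push_cast
      ring

/-- The homomorphic product of a matrix and an encrypted vector consists of encryptions (though not
of fresh ones) of the entries of the product. -/
theorem mulVec_enc {n d : ℕ} (Z : Matrix (Fin n) (Fin d) (ZMod (E.modulus k (E.gen k g).1)))
    (w : Fin d → ZMod (E.modulus k (E.gen k g).1)) (r : Fin d → Bits (E.encCoins k)) (i : Fin n) :
    ∃ r', E.mulVec k (E.gen k g).1 Z (fun j => E.enc k (E.gen k g).1 (w j) (r j)) i
      = E.enc k (E.gen k g).1 (Z.mulVec w i) r' := by
  suffices H : ∀ (l : List (Fin d)) m r₀, ∃ r', l.foldl (fun acc j => E.add k (E.gen k g).1 acc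
      (E.smul k (E.gen k g).1 (E.msgLen k) (Z i j).val (E.enc k (E.gen k g).1 (w j) (r j))))
      (E.enc k (E.gen k g).1 m r₀)
      = E.enc k (E.gen k g).1 (m + (l.map fun j => Z i j * w j).sum) r' by
    obtain ⟨r', h⟩ := H (List.finRange d) 0 fun _ => false
    refine ⟨r', ?_⟩
    rw [mulVec, encZero, h, zero_add, Matrix.mulVec, dotProduct, Fin.sum_univ_def]
  intro l
  induction l with
  | nil => exact fun m r₀ => ⟨r₀, by simp⟩
  | cons j l ih =>
    intro m r₀
    obtain ⟨r₁, h₁⟩ := E.smul_enc k g (w j) (r j) (E.msgLen k) (Z i j).val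
    obtain ⟨r₂, h₂⟩ := E.add_enc k g m (Z i j * w j) r₀ r₁
    have hlt : (Z i j).val < 2 ^ E.msgLen k := (Z i j).val_lt.trans (E.modulus k _).2.2
    rw [Nat.mod_eq_of_lt hlt, ZMod.natCast_zmod_val] at h₁
    obtain ⟨r', h'⟩ := ih (m + Z i j * w j) r₂
    refine ⟨r', ?_⟩
    rw [List.foldl_cons, h₁, h₂, h', List.map_cons, List.sum_cons, add_assoc]

end AHE

/-- The garbled circuit and the labels of the input `x`, for given garbling coins. -/
def GarblingScheme.encryptWith (Γ : GarblingScheme) (k : ℕ) {ι κ : Type} [Finite ι] [Finite κ]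
    (C : Circ ι κ) (x : ι → Bool) (r : Bits (Γ.coins k C)) :
    Fin (Γ.gcLen k C) ⊕ ι × Fin (Γ.labelLen k) → Bool :=
  Sum.elim (Γ.garble k C r).gc (fun p => (Γ.garble k C r).inLabel p.1 (x p.1) p.2)

namespace SecShGC

variable {n d : ℕ → ℕ} (P : SecShGC n d)

/-- The entrywise encryption of a vector. -/
def encVec (k : ℕ) (pk : Bits (P.E.pkLen k)) {m : ℕ} (v : Fin m → ZMod (P.q k pk))
    (r : Fin m → Bits (P.E.encCoins k)) : Fin m → Bits (P.E.ctLen k) :=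
  fun j => P.E.enc k pk (v j) (r j)

/-- CSP's message: the homomorphic product `Z₁ E(w)` plus fresh encryptions of the noise `u`. -/
def addNoise (k : ℕ) (pk : Bits (P.E.pkLen k)) (x : Inputs (n k) (d k) (P.q k pk))
    (r : P.CloudTape k) (u : Fin (n k) → ZMod (P.q k pk)) (e : Fin (n k) → Bits (P.E.encCoins k)) :
    Fin (n k) → Bits (P.E.ctLen k) :=
  fun i => P.E.add k pk (P.E.mulVec k pk x.Z₁ (P.encVec k pk x.w r) i) (P.E.enc k pk (u i) (e i))

/-- The input bits of the sign-checking circuit for the noise `u`. -/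
def signInput (k : ℕ) (pk : Bits (P.E.pkLen k)) (x : Inputs (n k) (d k) (P.q k pk))
    (u : Fin (n k) → ZMod (P.q k pk)) : SignIn (n k) (P.E.msgLen k) → Bool :=
  Sum.elim (cspBits (P.q k pk) u)
    (resBits (P.E.msgLen k) fun i => x.Z₀.mulVec x.w i + (x.Z₁.mulVec x.w i + u i))

/-- Cloud's view, assembled from the messages: the ciphertexts `ct` and, in `y`, the garbled circuit
with the labels of all inputs. -/
def cloudView (k : ℕ) (g : Bits (P.E.genCoins k)) (x : Inputs (n k) (d k) (P.q k (P.pk k g)))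
    (r : P.CloudTape k) (ct : Fin (n k) → Bits (P.E.ctLen k))
    (y : Fin (P.Γ.gcLen k (P.circ k)) ⊕
      SignIn (n k) (P.E.msgLen k) × Fin (P.Γ.labelLen k) → Bool) : P.ViewIdx .cloud k → Bool :=
  Sum.elim
    (Sum.elim g (Sum.elim (matBits _ x.Z₀) (Sum.elim (resBits _ x.w) (fun p => r p.1 p.2))))
    (Sum.elim (fun p => ct p.1 p.2) (Sum.elim (fun i => y (.inl i))
      (Sum.elim (fun p => y (.inr (.inl p.1, p.2))) (fun p => y (.inr (.inr p.1, p.2))))))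

/-- CSP's view, assembled from its input share `Z`, its coins `s`, the ciphertexts `ct`, and the
indicator vector `I`, which determines the output labels. -/
def cspView (k : ℕ) (pk : Bits (P.E.pkLen k))
    (Z : (Fin (n k) × Fin (d k)) × Fin (P.E.msgLen k) → Bool) (s : P.CSPTape k)
    (ct : Fin (d k) → Bits (P.E.ctLen k)) (I : Fin (n k) → Bool) : P.ViewIdx .csp k → Bool :=
  Sum.elim
    (Sum.elim pk (Sum.elim Z (Sum.elim s.1 (Sum.elim (fun p => s.2.1 p.1 p.2) s.2.2))))
    (Sum.elim (fun p => ct p.1 p.2)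
      (fun p => (P.Γ.garble k (P.circ k) s.2.2).outLabel p.1 (!I p.1) p.2))

variable (k : ℕ) (g : Bits (P.E.genCoins k)) (x : Inputs (n k) (d k) (P.q k (P.pk k g)))

theorem dec_addNoise (r : P.CloudTape k) (u : Fin (n k) → ZMod (P.q k (P.pk k g)))
    (e : Fin (n k) → Bits (P.E.encCoins k)) (i : Fin (n k)) :
    P.E.dec k (P.pk k g) (P.E.gen k g).2 (P.addNoise k (P.pk k g) x r u e i)
      = x.Z₁.mulVec x.w i + u i := by
  obtain ⟨r₁, h₁⟩ := P.E.mulVec_enc k g x.Z₁ x.w r i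
  obtain ⟨r₂, h₂⟩ := P.E.add_enc k g (x.Z₁.mulVec x.w i) (u i) r₁ (e i)
  rw [addNoise]
  unfold encVec
  rw [h₁, h₂, P.E.dec_enc]

/-- The noise cancels: the circuit outputs the sign bits of `(Z₀ + Z₁) w`. -/
theorem circ_signInput (u : Fin (n k) → ZMod (P.q k (P.pk k g))) :
    (P.circ k).eval (P.signInput k (P.pk k g) x u) = fun i => !idealF x i := by
  rw [signInput, P.circ_eval]
  funext i
  rw [idealF, Bool.not_not, Matrix.add_mulVec, Pi.add_apply]
  congr 1
  ring

/-- An honest execution: Cloud evaluates the garbled circuit on `signInput`, and CSP outputs what the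
ideal functionality prescribes. -/
theorem exec_eq (r : P.CloudTape k) (s : P.CSPTape k) :
    P.exec k g x r s =
      { encW := P.encVec k (P.pk k g) x.w r
        encNoisy := P.addNoise k (P.pk k g) x r (P.G.gen k (P.q k (P.pk k g)) s.1) s.2.1
        gc := (P.Γ.garble k (P.circ k) s.2.2).gc
        cspLabels := fun i => (P.Γ.garble k (P.circ k) s.2.2).inLabel (.inl i)
          (P.signInput k (P.pk k g) x (P.G.gen k (P.q k (P.pk k g)) s.1) (.inl i))
        cloudLabels := fun i => (P.Γ.garble k (P.circ k) s.2.2).inLabel (.inr i)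
          (P.signInput k (P.pk k g) x (P.G.gen k (P.q k (P.pk k g)) s.1) (.inr i))
        outLabels := fun i => (P.Γ.garble k (P.circ k) s.2.2).outLabel i (!idealF x i)
        indicator := idealF x } := by
  set u := P.G.gen k (P.q k (P.pk k g)) s.1 with hu
  have hu₀ : (fun i => x.Z₀.mulVec x.w i + P.E.dec k (P.pk k g) (P.E.gen k g).2
      (P.addNoise k (P.pk k g) x r u s.2.1 i))
      = fun i => x.Z₀.mulVec x.w i + (x.Z₁.mulVec x.w i + u i) := by
    funext i
    rw [dec_addNoise]
  have hcl : idealOT (fun i => (P.Γ.garble k (P.circ k) s.2.2).inLabel (.inr i))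
      (resBits (P.E.msgLen k) fun i => x.Z₀.mulVec x.w i + P.E.dec k (P.pk k g) (P.E.gen k g).2
        (P.addNoise k (P.pk k g) x r u s.2.1 i))
      = fun i => (P.Γ.garble k (P.circ k) s.2.2).inLabel (.inr i)
          (P.signInput k (P.pk k g) x u (.inr i)) := by
    rw [hu₀]; rfl
  have hout : P.Γ.eval k (P.circ k) (P.Γ.garble k (P.circ k) s.2.2).gc
      (Sum.elim (fun i => (P.Γ.garble k (P.circ k) s.2.2).inLabel (.inl i)
          (P.signInput k (P.pk k g) x u (.inl i)))
        (fun i => (P.Γ.garble k (P.circ k) s.2.2).inLabel (.inr i)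
          (P.signInput k (P.pk k g) x u (.inr i))))
      = fun i => (P.Γ.garble k (P.circ k) s.2.2).outLabel i (!idealF x i) := by
    have h := P.Γ.eval_garble k (P.circ k) s.2.2 (P.signInput k (P.pk k g) x u)
    rw [circ_signInput] at h
    rw [← h]
    congr 1
    funext i
    rcases i with i | i <;> rfl
  rw [← hcl] at hout
  -- The two labels of an output wire differ, so CSP recovers the bit from the label.
  have hind : (fun i => !decide ((P.Γ.garble k (P.circ k) s.2.2).outLabel i (!idealF x i)
      = (P.Γ.garble k (P.circ k) s.2.2).outLabel i true)) = idealF x := by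
    funext i
    cases h : idealF x i
    · simp
    · simp [P.Γ.outLabel_ne k (P.circ k) s.2.2 i]
  rw [exec, Transcript.mk.injEq]
  exact ⟨rfl, rfl, rfl, rfl, hcl, hout, (congrArg (fun (L : Fin (n k) → Bits (P.Γ.labelLen k)) i =>
    !decide (L i = (P.Γ.garble k (P.circ k) s.2.2).outLabel i true)) hout).trans hind⟩

theorem view_cloud (r : P.CloudTape k) (s : P.CSPTape k) :
    P.view .cloud k g x r s
      = P.cloudView k g x r
        (P.addNoise k (P.pk k g) x r (P.G.gen k (P.q k (P.pk k g)) s.1) s.2.1)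
        (P.Γ.encryptWith k (P.circ k)
          (P.signInput k (P.pk k g) x (P.G.gen k (P.q k (P.pk k g)) s.1)) s.2.2) := by
  rw [view, exec_eq]
  rfl

theorem view_csp (r : P.CloudTape k) (s : P.CSPTape k) :
    P.view .csp k g x r s = P.cspView k (P.pk k g) (matBits _ x.Z₁) s
      (P.encVec k (P.pk k g) x.w r) (idealF x) := by
  rw [view, exec_eq]
  rfl

end SecShGC

/-! ### The coins of the simulators -/

theorem BitwisePoly.sumElim_family {α ι J κ μ : ℕ → Type} {inp : ∀ k, α k → ι k → Bool}
    {f : ∀ k, α k → J k → κ k → Bool} {g : ∀ k, α k → J k → μ k → Bool}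
    (hf : BitwisePoly (κ := fun k => J k × κ k) inp fun k a p => f k a p.1 p.2)
    (hg : BitwisePoly (κ := fun k => J k × μ k) inp fun k a p => g k a p.1 p.2) :
    BitwisePoly (κ := fun k => J k × (κ k ⊕ μ k)) inp
      fun k a p => Sum.elim (f k a p.1) (g k a p.1) p.2 := by
  obtain ⟨N, hN, hf⟩ := hf
  obtain ⟨M, hM, hg⟩ := hg
  refine ⟨fun k => N k + M k, hN.add hM, ?_⟩
  rintro k ⟨j, o | o⟩
  · exact (hf k (j, o)).mono (Nat.le_add_right _ _)
  · exact (hg k (j, o)).mono (Nat.le_add_left _ _)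

namespace SecShGC

variable {n d : ℕ → ℕ} (P : SecShGC n d)

/-- The coins of a simulator for an adversary with `m k` coins: it tosses the coins of Cloud, of the
adversary, and of CSP. -/
abbrev SimTape (m : ℕ → ℕ) (k : ℕ) : Type := P.CloudTape k × Bits (m k) × P.CSPTape k

/-- Index type of the bits of `SimTape`. -/
abbrev SimTapeIdx (m : ℕ → ℕ) (k : ℕ) : Type :=
  (Fin (d k) × Fin (P.E.encCoins k)) ⊕ Fin (m k) ⊕ Fin (P.G.seedLen k) ⊕
    (Fin (n k) × Fin (P.E.encCoins k)) ⊕ Fin (P.Γ.coins k (P.circ k))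

/-- The simulator's coins as a bit string. -/
def simTapeEquiv (m : ℕ → ℕ) (k : ℕ) : P.SimTape m k ≃ (P.SimTapeIdx m k → Bool) where
  toFun ω := Sum.elim (fun p => ω.1 p.1 p.2) (Sum.elim ω.2.1 (Sum.elim ω.2.2.1
    (Sum.elim (fun p => ω.2.2.2.1 p.1 p.2) ω.2.2.2.2)))
  invFun b := (fun i j => b (.inl (i, j)), fun i => b (.inr (.inl i)),
    fun i => b (.inr (.inr (.inl i))), fun i j => b (.inr (.inr (.inr (.inl (i, j))))),
    fun i => b (.inr (.inr (.inr (.inr i)))))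
  left_inv _ := rfl
  right_inv b := by
    funext i
    rcases i with i | i | i | i | i <;> rfl

theorem genCoins_bounded : PolyBounded P.E.genCoins := by
  simpa using P.E.gen_poly.input_bounded

theorem pkLen_bounded : PolyBounded P.E.pkLen := by
  simpa using P.E.modulus_poly.input_bounded

theorem msgLen_bounded : PolyBounded P.E.msgLen := by
  simpa using P.E.modulus_poly.output_bounded

theorem encCoins_bounded : PolyBounded P.E.encCoins :=
  P.E.enc_poly.input_bounded.mono fun k => by simp only [Fintype.card_sum, Fintype.card_fin]; omega

theorem ctLen_bounded : PolyBounded P.E.ctLen := by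
  simpa using P.E.enc_poly.output_bounded

theorem seedLen_bounded : PolyBounded P.G.seedLen :=
  P.G.gen_poly.input_bounded.mono fun k => by simp only [Fintype.card_sum, Fintype.card_fin]; omega

theorem garbleCoins_bounded : PolyBounded fun k => P.Γ.coins k (P.circ k) := by
  simpa using (P.Γ.garble_poly _ _ P.circ P.circ_poly).input_bounded

theorem simTapeIdx_bounded (hn : PolyBounded n) (hd : PolyBounded d) {m : ℕ → ℕ}
    (hm : PolyBounded m) : PolyBounded fun k => Fintype.card (P.SimTapeIdx m k) := by
  simp only [Fintype.card_sum, Fintype.card_prod, Fintype.card_fin]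
  exact (hd.mul P.encCoins_bounded).add (hm.add (P.seedLen_bounded.add
    ((hn.mul P.encCoins_bounded).add P.garbleCoins_bounded)))

variable {c : Party} {inLen outLen : ℕ → ℕ}

theorem Adversary.coins_bounded {P : SecShGC n d} (A : P.Adversary c inLen outLen) :
    PolyBounded A.coins :=
  A.poly.input_bounded.mono fun k => by simp only [Fintype.card_sum, Fintype.card_fin]; omega

theorem Adversary.inLen_bounded {P : SecShGC n d} (A : P.Adversary c inLen outLen) :
    PolyBounded inLen :=
  A.poly.input_bounded.mono fun k => by simp only [Fintype.card_sum, Fintype.card_fin]; omega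

/-! ### Circuits for the messages -/

section Messages

variable {α ι : ℕ → Type} {inp : ∀ k, α k → ι k → Bool}

theorem encVec_poly {m : ℕ → ℕ} {pk : ∀ k, α k → Bits (P.E.pkLen k)}
    {v : ∀ k a, Fin (m k) → ZMod (P.q k (pk k a))}
    {e : ∀ k, α k → Fin (m k) → Bits (P.E.encCoins k)} (hpk : BitwisePoly inp pk)
    (hv : BitwisePoly inp fun k a => resBits (P.E.msgLen k) (v k a))
    (he : BitwisePoly (κ := fun k => Fin (m k) × Fin (P.E.encCoins k)) inp
      fun k a p => e k a p.1 p.2) :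
    BitwisePoly (κ := fun k => Fin (m k) × Fin (P.E.ctLen k)) inp
      fun k a p => P.encVec k (pk k a) (v k a) (e k a) p.1 p.2 := by
  have h := BitwisePoly.sumElim_family (J := fun k => Fin (m k)) (f := fun k a _ => pk k a)
    (g := fun k a j => Sum.elim (natBits (P.E.msgLen k) (v k a j).val) (e k a j))
    (hpk.reindex fun _ (p : _ × _) => p.2)
    (.sumElim_family (f := fun k a j => natBits (P.E.msgLen k) (v k a j).val) hv he)
  exact BitwisePoly.apply P.E.enc_poly (J := fun k => Fin (m k))
    (fun k j a => ⟨pk k a, v k a j, e k a j⟩) h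

/-- Adding encrypted noise `u` to hard-wired ciphertexts. -/
theorem addNoise_poly {pk : ∀ k, Bits (P.E.pkLen k)}
    (x : ∀ k, Inputs (n k) (d k) (P.q k (pk k))) (r : ∀ k, P.CloudTape k)
    {u : ∀ k, α k → Fin (n k) → ZMod (P.q k (pk k))}
    (e : ∀ k, Fin (n k) → Bits (P.E.encCoins k))
    (hu : BitwisePoly inp fun k a => resBits (P.E.msgLen k) (u k a)) :
    BitwisePoly (κ := fun k => Fin (n k) × Fin (P.E.ctLen k)) inp
      fun k a p => P.addNoise k (pk k) (x k) (r k) (u k a) (e k) p.1 p.2 := by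
  have h := BitwisePoly.sumElim_family (J := fun k => Fin (n k)) (f := fun k (_ : α k) _ => pk k)
    (g := fun k a j => Sum.elim (P.E.mulVec k (pk k) (x k).Z₁ (P.encVec k (pk k) (x k).w (r k)) j)
      (P.encVec k (pk k) (u k a) (e k) j)) (.const fun k (p : _ × _) => pk k p.2)
    (.sumElim_family
      (f := fun k _ j => P.E.mulVec k (pk k) (x k).Z₁ (P.encVec k (pk k) (x k).w (r k)) j)
      (.const fun k (p : _ × _) => P.E.mulVec k (pk k) (x k).Z₁ (P.encVec k (pk k) (x k).w (r k)) p.1 p.2)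
      (P.encVec_poly (pk := fun k _ => pk k) (.const pk) hu (.const fun k (p : _ × _) => e k p.1 p.2)))
  exact BitwisePoly.apply P.E.add_poly (J := fun k => Fin (n k))
    (fun k j a => (pk k, P.E.mulVec k (pk k) (x k).Z₁ (P.encVec k (pk k) (x k).w (r k)) j,
      P.encVec k (pk k) (u k a) (e k) j)) h

theorem encryptWith_false_poly {gr : ∀ k, α k → Bits (P.Γ.coins k (P.circ k))}
    (hgr : BitwisePoly inp gr) :
    BitwisePoly inp fun k a => P.Γ.encryptWith k (P.circ k) (fun _ => false) (gr k a) := by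
  have h := BitwisePoly.apply_one (P.Γ.garble_poly _ _ P.circ P.circ_poly) gr hgr
  exact .sumElim (f := fun k a => (P.Γ.garble k (P.circ k) (gr k a)).gc)
    (h.reindex (μ := fun k => Fin (P.Γ.gcLen k (P.circ k))) fun _ i => .inl i)
    (h.reindex (μ := fun k => SignIn (n k) (P.E.msgLen k) × Fin (P.Γ.labelLen k))
      fun _ p => .inr (.inl ((p.1, false), p.2)))

end Messages

end SecShGC

namespace SecShGC

variable {n d : ℕ → ℕ} (P : SecShGC n d)

/-! ### Corrupted Cloud -/

section Cloud

variable {P} {inLen outLen : ℕ → ℕ} (A : P.Adversary .cloud inLen outLen)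
  (Z : P.Environment .cloud inLen outLen)

/-- The coins other than those of CSP: of the key generation, of the environment's choice, of Cloud,
of the adversary, and of the environment's answer. -/
abbrev OuterCoins {c : Party} (A : P.Adversary c inLen outLen) (Z : P.Environment c inLen outLen)
    (k : ℕ) : Type :=
  Bits (P.E.genCoins k) × Bits (Z.coins k) × P.CloudTape k × Bits (A.coins k) ×
    Bits (Z.answer.coins k)

/-- The environment's choice when Cloud is corrupted. -/
abbrev cloudChoice (k : ℕ) (c : OuterCoins A Z k) :
    Inputs (n k) (d k) (P.q k (P.pk k c.1)) × Bits (inLen k) × Bits (Z.stLen k) :=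
  Z.choose k (P.pk k c.1) (P.secret .cloud k c.1) c.2.1

/-- The environment's answer if Cloud is corrupted and receives the ciphertexts `ct` and the garbled
circuit and labels `y`. -/
def cloudAnswer (k : ℕ) (c : OuterCoins A Z k) (ct : Fin (n k) → Bits (P.E.ctLen k))
    (y : Fin (P.Γ.gcLen k (P.circ k)) ⊕
      SignIn (n k) (P.E.msgLen k) × Fin (P.Γ.labelLen k) → Bool) : Bool :=
  Z.answer.run k (Sum.elim (cloudChoice A Z k c).2.2
    (Sum.elim (A.run k (Sum.elim (P.cloudView k c.1 (cloudChoice A Z k c).1 c.2.2.1 ct y)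
      (cloudChoice A Z k c).2.1) c.2.2.2.1)
    (idealF (cloudChoice A Z k c).1))) c.2.2.2.2 ()

theorem cloudView_poly {α ι : ℕ → Type} {inp : ∀ k, α k → ι k → Bool}
    {g : ∀ k, α k → Bits (P.E.genCoins k)}
    {x : ∀ k a, Inputs (n k) (d k) (P.q k (P.pk k (g k a)))} {r : ∀ k, α k → P.CloudTape k}
    {ct : ∀ k, α k → Fin (n k) → Bits (P.E.ctLen k)}
    {y : ∀ k, α k → Fin (P.Γ.gcLen k (P.circ k)) ⊕
      SignIn (n k) (P.E.msgLen k) × Fin (P.Γ.labelLen k) → Bool}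
    (hg : BitwisePoly inp g)
    (hZ : BitwisePoly inp fun k a => matBits (P.E.msgLen k) (x k a).Z₀)
    (hw : BitwisePoly inp fun k a => resBits (P.E.msgLen k) (x k a).w)
    (hr : BitwisePoly (κ := fun k => Fin (d k) × Fin (P.E.encCoins k)) inp
      fun k a p => r k a p.1 p.2)
    (hct : BitwisePoly (κ := fun k => Fin (n k) × Fin (P.E.ctLen k)) inp
      fun k a p => ct k a p.1 p.2)
    (hy : BitwisePoly inp y) :
    BitwisePoly inp fun k a => P.cloudView k (g k a) (x k a) (r k a) (ct k a) (y k a) :=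
  .sumElim (.sumElim hg (.sumElim hZ (.sumElim hw hr)))
    (.sumElim hct (.sumElim
      (hy.reindex (μ := fun k => Fin (P.Γ.gcLen k (P.circ k))) fun _ i => .inl i)
      (.sumElim
        (hy.reindex (μ := fun k => (Fin (P.E.msgLen k) ⊕ Fin (n k) × Fin (P.E.msgLen k)) ×
          Fin (P.Γ.labelLen k)) fun _ p => .inr (.inl p.1, p.2))
        (hy.reindex (μ := fun k => (Fin (n k) × Fin (P.E.msgLen k)) × Fin (P.Γ.labelLen k))
          fun _ p => .inr (.inr p.1, p.2)))))

theorem cloudAnswer_poly {α ι : ℕ → Type} {inp : ∀ k, α k → ι k → Bool}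
    (c : ∀ k, OuterCoins A Z k) {ct : ∀ k, α k → Fin (n k) → Bits (P.E.ctLen k)}
    {y : ∀ k, α k → Fin (P.Γ.gcLen k (P.circ k)) ⊕
      SignIn (n k) (P.E.msgLen k) × Fin (P.Γ.labelLen k) → Bool}
    (hct : BitwisePoly (κ := fun k => Fin (n k) × Fin (P.E.ctLen k)) inp
      fun k a p => ct k a p.1 p.2)
    (hy : BitwisePoly inp y) :
    BitwisePoly inp fun k a (_ : Unit) => cloudAnswer A Z k (c k) (ct k a) (y k a) := by
  have hview := cloudView_poly (P := P) (inp := inp) (g := fun k _ => (c k).1)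
    (x := fun k _ => (cloudChoice A Z k (c k)).1) (r := fun k _ => (c k).2.2.1)
    (.const _) (.const _) (.const _) (.const fun k (p : _ × _) => (c k).2.2.1 p.1 p.2) hct hy
  have hA := BitwisePoly.apply_one A.poly
    (fun k a => (Sum.elim (P.cloudView k (c k).1 (cloudChoice A Z k (c k)).1 (c k).2.2.1 (ct k a)
      (y k a)) (cloudChoice A Z k (c k)).2.1, (c k).2.2.2.1))
    (.sumElim (.sumElim hview (.const _)) (.const _))
  exact BitwisePoly.apply_one Z.answer.poly
    (fun k a => (Sum.elim (cloudChoice A Z k (c k)).2.2 (Sum.elim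
      (A.run k (Sum.elim (P.cloudView k (c k).1 (cloudChoice A Z k (c k)).1 (c k).2.2.1 (ct k a)
        (y k a)) (cloudChoice A Z k (c k)).2.1) (c k).2.2.2.1)
      (idealF (cloudChoice A Z k (c k)).1)), (c k).2.2.2.2))
    (.sumElim (.sumElim (.const _) (.sumElim hA (.const _))) (.const _))

theorem toReal_real_cloud (k : ℕ) :
    (P.real A Z k true).toReal = 𝔼 c : OuterCoins A Z k, 𝔼 s : P.CSPTape k,
      indic (cloudAnswer A Z k c
        (P.addNoise k (P.pk k c.1) (cloudChoice A Z k c).1 c.2.2.1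
          (P.G.gen k (P.q k (P.pk k c.1)) s.1) s.2.1)
        (P.Γ.encryptWith k (P.circ k) (P.signInput k (P.pk k c.1) (cloudChoice A Z k c).1
          (P.G.gen k (P.q k (P.pk k c.1)) s.1)) s.2.2)) := by
  rw [expect_prod]
  refine (PMF.toReal_unif_bind _ _).trans (Finset.expect_congr rfl fun g _ => ?_)
  rw [expect_prod]
  refine (PMF.toReal_unif_bind _ _).trans (Finset.expect_congr rfl fun ρ _ => ?_)
  rw [expect_prod]
  refine (PMF.toReal_unif_bind _ _).trans (Finset.expect_congr rfl fun r _ => ?_)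
  rw [Finset.expect_comm]
  refine (PMF.toReal_unif_bind _ _).trans (Finset.expect_congr rfl fun s _ => ?_)
  rw [expect_prod]
  refine (toReal_unif_map_bind _ _).trans (Finset.expect_congr rfl fun a _ => ?_)
  rw [PPT.toReal_bit, view_cloud, exec_eq]
  rfl

theorem toReal_ideal_cloud (S : P.Simulator .cloud inLen outLen) (hS : ∀ k
      (g : Bits (P.E.genCoins k)) (x : Inputs (n k) (d k) (P.q k (P.pk k g))) (m : Bits (inLen k)),
      S.dist k (Sum.elim (P.idealView .cloud k g x) m)
        = (unif (P.SimTape A.coins k)).map fun ω => A.run k (Sum.elim (P.cloudView k g x ω.1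
          (P.encVec k (P.pk k g) (P.G.gen k (P.q k (P.pk k g)) ω.2.2.1) ω.2.2.2.1)
          (P.Γ.encryptWith k (P.circ k) (fun _ => false) ω.2.2.2.2)) m) ω.2.1) (k : ℕ) :
    (P.ideal S Z k true).toReal = 𝔼 c : OuterCoins A Z k, 𝔼 s : P.CSPTape k,
      indic (cloudAnswer A Z k c
        (P.encVec k (P.pk k c.1) (P.G.gen k (P.q k (P.pk k c.1)) s.1) s.2.1)
        (P.Γ.encryptWith k (P.circ k) (fun _ => false) s.2.2)) := by
  rw [expect_prod]
  refine (PMF.toReal_unif_bind _ _).trans (Finset.expect_congr rfl fun g _ => ?_)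
  rw [expect_prod]
  refine (PMF.toReal_unif_bind _ _).trans (Finset.expect_congr rfl fun ρ _ => ?_)
  dsimp only
  rw [hS]
  refine (toReal_unif_map_bind _ _).trans ?_
  rw [expect_prod, expect_prod]
  refine Finset.expect_congr rfl fun r _ => ?_
  rw [expect_prod, expect_prod]
  refine Finset.expect_congr rfl fun a _ => ?_
  rw [Finset.expect_comm]
  refine Finset.expect_congr rfl fun s _ => ?_
  rw [PPT.toReal_bit]
  rfl

/-- The simulator for a corrupted Cloud: it replaces the ciphertexts by fresh encryptions of
pseudo-random noise, and the garbled input by the all-false one. -/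
theorem exists_cloud_simulator (hn : PolyBounded n) (hd : PolyBounded d) :
    ∃ S : P.Simulator .cloud inLen outLen, ∀ k
      (g : Bits (P.E.genCoins k)) (x : Inputs (n k) (d k) (P.q k (P.pk k g))) (m : Bits (inLen k)),
      S.dist k (Sum.elim (P.idealView .cloud k g x) m)
        = (unif (P.SimTape A.coins k)).map fun ω => A.run k (Sum.elim (P.cloudView k g x ω.1
          (P.encVec k (P.pk k g) (P.G.gen k (P.q k (P.pk k g)) ω.2.2.1) ω.2.2.2.1)
          (P.Γ.encryptWith k (P.circ k) (fun _ => false) ω.2.2.2.2)) m) ω.2.1 := by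
  let α (k : ℕ) : Type :=
    (g : Bits (P.E.genCoins k)) × Inputs (n k) (d k) (P.q k (P.pk k g)) × Bits (inLen k)
  let inp (k : ℕ) (a : α k) : P.IdealIdx .cloud k ⊕ Fin (inLen k) → Bool :=
    Sum.elim (P.idealView .cloud k a.1 a.2.1) a.2.2
  suffices H : PolyComputable (α := fun k => α k × P.SimTape A.coins k)
      (fun k b => Sum.elim (inp k b.1) (P.simTapeEquiv A.coins k b.2))
      (fun k b => A.run k (Sum.elim (P.cloudView k b.1.1 b.1.2.1 b.2.1
        (P.encVec k (P.pk k b.1.1) (P.G.gen k (P.q k (P.pk k b.1.1)) b.2.2.2.1) b.2.2.2.2.1)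
        (P.Γ.encryptWith k (P.circ k) (fun _ => false) b.2.2.2.2.2)) b.1.2.2) b.2.2.1) by
    obtain ⟨S, hS⟩ := exists_PPT inp (P.simTapeEquiv A.coins) (fun k a ω =>
      A.run k (Sum.elim (P.cloudView k a.1 a.2.1 ω.1
        (P.encVec k (P.pk k a.1) (P.G.gen k (P.q k (P.pk k a.1)) ω.2.2.1) ω.2.2.2.1)
        (P.Γ.encryptWith k (P.circ k) (fun _ => false) ω.2.2.2.2)) a.2.2) ω.2.1) H
    exact ⟨S, fun k g x m => hS k ⟨g, x, m⟩⟩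
  refine BitwisePoly.polyComputable ?_ ?_ A.poly.output_bounded
  · set inp' : ∀ k, α k × P.SimTape A.coins k →
        (P.IdealIdx .cloud k ⊕ Fin (inLen k)) ⊕ P.SimTapeIdx A.coins k → Bool :=
      fun k b => Sum.elim (inp k b.1) (P.simTapeEquiv A.coins k b.2) with hinp'
    have hg : BitwisePoly inp' fun k b => b.1.1 :=
      BitwisePoly.input (inp := inp') (κ := fun k => Fin (P.E.genCoins k)) fun _ i => .inl (.inl (.inl i))
    have hZ : BitwisePoly inp' fun k b => matBits (P.E.msgLen k) b.1.2.1.Z₀ :=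
      BitwisePoly.input (inp := inp') (κ := fun k => (Fin (n k) × Fin (d k)) × Fin (P.E.msgLen k))
        fun _ i => .inl (.inl (.inr (.inl i)))
    have hw : BitwisePoly inp' fun k b => resBits (P.E.msgLen k) b.1.2.1.w :=
      BitwisePoly.input (inp := inp') (κ := fun k => Fin (d k) × Fin (P.E.msgLen k))
        fun _ i => .inl (.inl (.inr (.inr i)))
    have hm : BitwisePoly inp' fun k b => b.1.2.2 :=
      BitwisePoly.input (inp := inp') (κ := fun k => Fin (inLen k)) fun _ i => .inl (.inr i)
    have hr : BitwisePoly (κ := fun k => Fin (d k) × Fin (P.E.encCoins k)) inp'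
        fun k b p => b.2.1 p.1 p.2 :=
      BitwisePoly.input (inp := inp') (κ := fun k => Fin (d k) × Fin (P.E.encCoins k)) fun _ i => .inr (.inl i)
    have ha : BitwisePoly inp' fun k b => b.2.2.1 :=
      BitwisePoly.input (inp := inp') (κ := fun k => Fin (A.coins k)) fun _ i => .inr (.inr (.inl i))
    have hsd : BitwisePoly inp' fun k b => b.2.2.2.1 :=
      BitwisePoly.input (inp := inp') (κ := fun k => Fin (P.G.seedLen k)) fun _ i => .inr (.inr (.inr (.inl i)))
    have he : BitwisePoly (κ := fun k => Fin (n k) × Fin (P.E.encCoins k)) inp'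
        fun k b p => b.2.2.2.2.1 p.1 p.2 :=
      BitwisePoly.input (inp := inp') (κ := fun k => Fin (n k) × Fin (P.E.encCoins k)) fun _ i => .inr (.inr (.inr (.inr (.inl i))))
    have hgr : BitwisePoly inp' fun k b => b.2.2.2.2.2 :=
      BitwisePoly.input (inp := inp') (κ := fun k => Fin (P.Γ.coins k (P.circ k)))
        fun _ i => .inr (.inr (.inr (.inr (.inr i))))
    have hpk : BitwisePoly inp' fun k b => P.pk k b.1.1 :=
      (BitwisePoly.apply_one P.E.gen_poly (fun k (b : α k × P.SimTape A.coins k) => b.1.1)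
        hg).reindex (μ := fun k => Fin (P.E.pkLen k)) fun _ i => .inl i
    have hq := BitwisePoly.apply_one P.E.modulus_poly
      (fun k (b : α k × P.SimTape A.coins k) => P.pk k b.1.1) hpk
    have hG := BitwisePoly.apply_one P.G.gen_poly
      (fun k (b : α k × P.SimTape A.coins k) => (P.q k (P.pk k b.1.1), b.2.2.2.1))
      (.sumElim hq hsd)
    have hview := cloudView_poly (P := P) (inp := inp') hg hZ hw hr
      (P.encVec_poly (v := fun k b => P.G.gen k (P.q k (P.pk k b.1.1)) b.2.2.2.1) hpk hG he)
      (P.encryptWith_false_poly hgr)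
    exact BitwisePoly.apply_one A.poly
      (fun k (b : α k × P.SimTape A.coins k) => (Sum.elim (P.cloudView k b.1.1 b.1.2.1 b.2.1
        (P.encVec k (P.pk k b.1.1) (P.G.gen k (P.q k (P.pk k b.1.1)) b.2.2.2.1) b.2.2.2.2.1)
        (P.Γ.encryptWith k (P.circ k) (fun _ => false) b.2.2.2.2.2)) b.1.2.2, b.2.2.1))
      (.sumElim (.sumElim hview hm) ha)
  · simp only [Fintype.card_sum]
    refine PolyBounded.add (.add ?_ ?_) ?_
    · simp only [Fintype.card_prod, Fintype.card_fin]
      exact P.genCoins_bounded.add (((hn.mul hd).mul P.msgLen_bounded).add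
        (hd.mul P.msgLen_bounded))
    · simpa using A.inLen_bounded
    · simpa using P.simTapeIdx_bounded hn hd A.coins_bounded

end Cloud

end SecShGC

/-! ### The hybrids for a corrupted Cloud -/

/-- Pseudo-randomness for a family of tests `b k ω`, uniformly in the parameter `ω`. -/
theorem NoiseGen.PseudoRandom.exists_bound {n B : ℕ → ℕ} {G : NoiseGen n B} (hG : G.PseudoRandom)
    (hn : PolyBounded n) (hB : PolyBounded B) {Ω : ℕ → Type} [∀ k, Finite (Ω k)]
    [∀ k, Nonempty (Ω k)] (q : ∀ k, Ω k → Modulus (B k))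
    (b : ∀ k (ω : Ω k), (Fin (n k) → ZMod (q k ω)) → Bool)
    (hb : ∀ ω : ∀ k, Ω k, BitwisePoly (α := fun k => Fin (n k) → ZMod (q k (ω k)))
      (fun k v => resBits (B k) v) fun k v (_ : Unit) => b k (ω k) v) :
    ∃ ε : ℕ → ℝ, Negligible ε ∧ ∀ k ω, |𝔼 s, indic (b k ω (G.gen k (q k ω) s))
      - 𝔼 v : Fin (n k) → ZMod (q k ω), indic (b k ω v)| ≤ ε k := by
  refine Negligible.exists_bound (fun k ω => |𝔼 s, indic (b k ω (G.gen k (q k ω) s))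
      - 𝔼 v : Fin (n k) → ZMod (q k ω), indic (b k ω v)|) fun ω => ?_
  obtain ⟨D, hD⟩ := exists_distinguisher (α := fun k => Fin (n k) → ZMod (q k (ω k)))
    (ι := fun k => Fin (n k) × Fin (B k)) (fun k v => resBits (B k) v) (fun k v => b k (ω k) v)
    (hb ω) (by simpa using hn.mul hB)
  have := hG (fun k => q k (ω k)) D
  simpa only [NegligibleGap, PMF.toReal_unif_bind, hD] using this

namespace SecShGC

variable {n d : ℕ → ℕ} {P : SecShGC n d} {inLen outLen : ℕ → ℕ}

section Cloud

variable (A : P.Adversary .cloud inLen outLen) (Z : P.Environment .cloud inLen outLen)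

/-- Security of garbling: Cloud cannot tell on which input the circuit is evaluated. -/
theorem cloud_garbling_bound (hΓ : P.Γ.CPASecure) :
    ∃ ε : ℕ → ℝ, Negligible ε ∧ ∀ k (c : OuterCoins A Z k) ct x₀ x₁,
      |𝔼 r, indic (cloudAnswer A Z k c ct (P.Γ.encryptWith k (P.circ k) x₀ r))
        - 𝔼 r, indic (cloudAnswer A Z k c ct (P.Γ.encryptWith k (P.circ k) x₁ r))| ≤ ε k := by
  have key := Negligible.exists_bound
    (Ω := fun k => OuterCoins A Z k × (Fin (n k) → Bits (P.E.ctLen k)) ×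
      (SignIn (n k) (P.E.msgLen k) → Bool) × (SignIn (n k) (P.E.msgLen k) → Bool))
    (fun k ω =>
      |𝔼 r, indic (cloudAnswer A Z k ω.1 ω.2.1 (P.Γ.encryptWith k (P.circ k) ω.2.2.1 r))
      - 𝔼 r, indic (cloudAnswer A Z k ω.1 ω.2.1 (P.Γ.encryptWith k (P.circ k) ω.2.2.2 r))|)
    fun ω => ?_
  · obtain ⟨ε, hε, h⟩ := key
    exact ⟨ε, hε, fun k c ct x₀ x₁ => h k (c, ct, x₀, x₁)⟩
  · obtain ⟨D, hD⟩ := exists_distinguisher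
      (α := fun k => Fin (P.Γ.gcLen k (P.circ k)) ⊕
        SignIn (n k) (P.E.msgLen k) × Fin (P.Γ.labelLen k) → Bool)
      (fun k y => y) (fun k y => cloudAnswer A Z k (ω k).1 (ω k).2.1 y)
      (cloudAnswer_poly A Z (fun k => (ω k).1) (.const fun k (p : _ × _) => (ω k).2.1 p.1 p.2)
        (.input (inp := fun k y => y) fun k o => o))
      ((P.Γ.eval_poly _ _ P.circ P.circ_poly).input_bounded)
    have := hΓ _ _ P.circ P.circ_poly (fun k => (ω k).2.2.1) (fun k => (ω k).2.2.2) D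
    simp only [NegligibleGap, GarblingScheme.encrypt, toReal_unif_map_bind, hD] at this
    exact this

/-- After the homomorphic addition of uniform noise, Cloud's ciphertexts are statistically close to
fresh encryptions of uniform residues. -/
theorem cloud_rerandomization_bound (hn : PolyBounded n) :
    ∃ ε : ℕ → ℝ, Negligible ε ∧ ∀ k (c : OuterCoins A Z k) y,
      |(𝔼 e, 𝔼 u, indic (cloudAnswer A Z k c
          (P.addNoise k (P.pk k c.1) (cloudChoice A Z k c).1 c.2.2.1 u e) y))
        - 𝔼 e, 𝔼 u, indic (cloudAnswer A Z k c (P.encVec k (P.pk k c.1) u e) y)| ≤ ε k := by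
  obtain ⟨ε, hε, h⟩ := P.E.add_fresh
  refine ⟨fun k => n k * (2 * ε k), Negligible.mul_polyBounded
    (Asymptotics.SuperpolynomialDecay.const_mul hε 2) hn, fun k c y => ?_⟩
  set x := (cloudChoice A Z k c).1
  -- The plaintexts `Z₁ w + u` are as uniform as `u`.
  have shift : (𝔼 e, 𝔼 u, indic (cloudAnswer A Z k c (P.encVec k (P.pk k c.1) u e) y))
      = 𝔼 u, 𝔼 e, indic (cloudAnswer A Z k c
        (P.encVec k (P.pk k c.1) (x.Z₁.mulVec x.w + u) e) y) := by
    rw [Finset.expect_comm]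
    exact (Fintype.expect_equiv (Equiv.addLeft (x.Z₁.mulVec x.w)) _ _ fun u => rfl).symm
  rw [shift, Finset.expect_comm]
  refine abs_expect_sub_expect_le fun u => ?_
  choose r' hr' using P.E.mulVec_enc k c.1 x.Z₁ x.w c.2.2.1
  have hadd (e : Fin (n k) → Bits (P.E.encCoins k)) :
      P.addNoise k (P.pk k c.1) x c.2.2.1 u e = fun i => P.E.add k (P.pk k c.1)
        (P.E.enc k (P.pk k c.1) (x.Z₁.mulVec x.w i) (r' i)) (P.E.enc k (P.pk k c.1) (u i) (e i)) := by
    funext i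
    rw [← hr']
    rfl
  simp only [hadd]
  exact abs_expect_pi_sub_le
    (fun i s => P.E.add k (P.pk k c.1) (P.E.enc k (P.pk k c.1) (x.Z₁.mulVec x.w i) (r' i))
      (P.E.enc k (P.pk k c.1) (u i) s))
    (fun i s => P.E.enc k (P.pk k c.1) ((x.Z₁.mulVec x.w + u) i) s)
    (fun i => h k c.1 (x.Z₁.mulVec x.w i) (u i) (r' i))
    (f := fun ct => indic (cloudAnswer A Z k c ct y)) (fun _ => indic_nonneg _)
    fun _ => indic_le_one _

/-- The hybrid argument for a corrupted Cloud. -/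
theorem cloud_secure (hn : PolyBounded n) (hd : PolyBounded d) (hG : P.G.PseudoRandom)
    (hΓ : P.Γ.CPASecure) :
    ∃ S : P.Simulator .cloud inLen outLen, ∀ Z : P.Environment .cloud inLen outLen,
      NegligibleGap (P.real A Z) (P.ideal S Z) := by
  obtain ⟨S, hS⟩ := exists_cloud_simulator A hn hd
  refine ⟨S, fun Z => ?_⟩
  obtain ⟨ε₁, hε₁, h₁⟩ := cloud_garbling_bound A Z hΓ
  obtain ⟨ε₃, hε₃, h₃⟩ := cloud_rerandomization_bound A Z hn
  obtain ⟨ε₂, hε₂, h₂⟩ := hG.exists_bound hn P.msgLen_bounded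
    (Ω := fun k => OuterCoins A Z k × (Fin (n k) → Bits (P.E.encCoins k)) ×
      Bits (P.Γ.coins k (P.circ k))) (fun k ω => P.q k (P.pk k ω.1.1))
    (fun k ω u => cloudAnswer A Z k ω.1
      (P.addNoise k (P.pk k ω.1.1) (cloudChoice A Z k ω.1).1 ω.1.2.2.1 u ω.2.1)
      (P.Γ.encryptWith k (P.circ k) (fun _ => false) ω.2.2))
    fun ω => cloudAnswer_poly A Z (fun k => (ω k).1)
      (P.addNoise_poly (fun k => (cloudChoice A Z k (ω k).1).1) (fun k => (ω k).1.2.2.1)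
        (fun k => (ω k).2.1) (.input (inp := fun k v => resBits _ v) fun _ i => i)) (.const _)
  obtain ⟨ε₄, hε₄, h₄⟩ := hG.exists_bound hn P.msgLen_bounded
    (Ω := fun k => OuterCoins A Z k × (Fin (n k) → Bits (P.E.encCoins k)) ×
      Bits (P.Γ.coins k (P.circ k))) (fun k ω => P.q k (P.pk k ω.1.1))
    (fun k ω u => cloudAnswer A Z k ω.1 (P.encVec k (P.pk k ω.1.1) u ω.2.1)
      (P.Γ.encryptWith k (P.circ k) (fun _ => false) ω.2.2))
    fun ω => cloudAnswer_poly A Z (fun k => (ω k).1)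
      (P.encVec_poly (pk := fun k _ => P.pk k (ω k).1.1) (.const _)
        (.input (inp := fun k v => resBits _ v) fun _ i => i)
        (.const fun k (p : _ × _) => (ω k).2.1 p.1 p.2)) (.const _)
  refine Negligible.of_abs_le (((hε₁.add hε₂).add hε₃).add hε₄) fun k => ?_
  rw [abs_abs, toReal_real_cloud, toReal_ideal_cloud A Z S hS]
  refine le_trans (abs_expect_sub_expect_le fun c => ?_) (le_abs_self _)
  -- The coins of CSP are split into the seed, the encryption coins, and the garbling coins.
  have split (F : Bits (P.G.seedLen k) → (Fin (n k) → Bits (P.E.encCoins k)) →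
      Bits (P.Γ.coins k (P.circ k)) → ℝ) :
      𝔼 s : P.CSPTape k, F s.1 s.2.1 s.2.2 = 𝔼 e, 𝔼 r, 𝔼 s, F s e r := by
    rw [expect_prod]
    simp only [expect_prod]
    rw [Finset.expect_comm]
    exact Finset.expect_congr rfl fun e _ => Finset.expect_comm _ _ _
  set x := (cloudChoice A Z k c).1
  set ans := fun ct y => indic (cloudAnswer A Z k c ct y)
  set enc₀ := P.Γ.encryptWith k (P.circ k) (fun _ => false)
  set gen := P.G.gen k (P.q k (P.pk k c.1))
  have s₁ : |(𝔼 s : P.CSPTape k, ans (P.addNoise k (P.pk k c.1) x c.2.2.1 (gen s.1) s.2.1)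
        (P.Γ.encryptWith k (P.circ k) (P.signInput k (P.pk k c.1) x (gen s.1)) s.2.2))
      - 𝔼 s : P.CSPTape k, ans (P.addNoise k (P.pk k c.1) x c.2.2.1 (gen s.1) s.2.1)
        (enc₀ s.2.2)| ≤ ε₁ k := by
    simp only [expect_prod]
    exact abs_expect_sub_expect_le fun s => abs_expect_sub_expect_le fun e => h₁ k c _ _ _
  have s₂ : |(𝔼 s : P.CSPTape k, ans (P.addNoise k (P.pk k c.1) x c.2.2.1 (gen s.1) s.2.1)
        (enc₀ s.2.2))
      - 𝔼 e, 𝔼 r, 𝔼 u, ans (P.addNoise k (P.pk k c.1) x c.2.2.1 u e) (enc₀ r)| ≤ ε₂ k := by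
    rw [split fun s e r => ans (P.addNoise k (P.pk k c.1) x c.2.2.1 (gen s) e) (enc₀ r)]
    exact abs_expect_sub_expect_le fun e => abs_expect_sub_expect_le fun r => h₂ k (c, e, r)
  have s₃ : |(𝔼 e, 𝔼 r, 𝔼 u, ans (P.addNoise k (P.pk k c.1) x c.2.2.1 u e) (enc₀ r))
      - 𝔼 e, 𝔼 r, 𝔼 u, ans (P.encVec k (P.pk k c.1) u e) (enc₀ r)| ≤ ε₃ k := by
    rw [Finset.expect_comm, Finset.expect_comm (f := fun e r => 𝔼 u,
      ans (P.encVec k (P.pk k c.1) u e) (enc₀ r))]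
    exact abs_expect_sub_expect_le fun r => h₃ k c _
  have s₄ : |(𝔼 e, 𝔼 r, 𝔼 u, ans (P.encVec k (P.pk k c.1) u e) (enc₀ r))
      - 𝔼 s : P.CSPTape k, ans (P.encVec k (P.pk k c.1) (gen s.1) s.2.1) (enc₀ s.2.2)|
      ≤ ε₄ k := by
    rw [abs_sub_comm, split fun s e r => ans (P.encVec k (P.pk k c.1) (gen s) e) (enc₀ r)]
    exact abs_expect_sub_expect_le fun e => abs_expect_sub_expect_le fun r => h₄ k (c, e, r)
  refine (abs_sub_le _ _ _).trans (add_le_add ((abs_sub_le _ _ _).trans (add_le_add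
    ((abs_sub_le _ _ _).trans (add_le_add s₁ s₂)) s₃)) s₄)

end Cloud

end SecShGC

namespace SecShGC

variable {n d : ℕ → ℕ} {P : SecShGC n d} {inLen outLen : ℕ → ℕ}

/-! ### Corrupted CSP -/

section CSP

theorem cspView_poly {α ι : ℕ → Type} {inp : ∀ k, α k → ι k → Bool}
    {pk : ∀ k, α k → Bits (P.E.pkLen k)}
    {M : ∀ k, α k → (Fin (n k) × Fin (d k)) × Fin (P.E.msgLen k) → Bool}
    {s : ∀ k, α k → P.CSPTape k} {ct : ∀ k, α k → Fin (d k) → Bits (P.E.ctLen k)}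
    {I : ∀ k, α k → Fin (n k) → Bool} (hpk : BitwisePoly inp pk) (hM : BitwisePoly inp M)
    (hsd : BitwisePoly inp fun k a => (s k a).1)
    (he : BitwisePoly (κ := fun k => Fin (n k) × Fin (P.E.encCoins k)) inp
      fun k a p => (s k a).2.1 p.1 p.2)
    (hgr : BitwisePoly inp fun k a => (s k a).2.2)
    (hct : BitwisePoly (κ := fun k => Fin (d k) × Fin (P.E.ctLen k)) inp
      fun k a p => ct k a p.1 p.2)
    (hI : BitwisePoly inp I) :
    BitwisePoly inp fun k a => P.cspView k (pk k a) (M k a) (s k a) (ct k a) (I k a) := by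
  have hgb := BitwisePoly.apply_one (P.Γ.garble_poly _ _ P.circ P.circ_poly)
    (fun k a => (s k a).2.2) hgr
  have hout : BitwisePoly (κ := fun k => Fin (n k) × Fin (P.Γ.labelLen k)) inp
      fun k a p => (P.Γ.garble k (P.circ k) (s k a).2.2).outLabel p.1 (!I k a p.1) p.2 := by
    have := BitwisePoly.ite (κ := fun k => Fin (n k) × Fin (P.Γ.labelLen k))
      (hI.reindex fun _ p => p.1) (hgb.reindex fun _ p => .inr (.inr ((p.1, false), p.2)))
      (hgb.reindex fun _ p => .inr (.inr ((p.1, true), p.2)))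
    convert this using 4 with k a p
    cases I k a p.1 <;> rfl
  exact .sumElim (.sumElim hpk (.sumElim hM (.sumElim hsd (.sumElim he hgr))))
    (.sumElim hct hout)

variable (A : P.Adversary .csp inLen outLen)

/-- The simulator for a corrupted CSP: it encrypts zeros instead of the classifier. -/
theorem exists_csp_simulator (hn : PolyBounded n) (hd : PolyBounded d) :
    ∃ S : P.Simulator .csp inLen outLen, ∀ k
      (g : Bits (P.E.genCoins k)) (x : Inputs (n k) (d k) (P.q k (P.pk k g))) (m : Bits (inLen k)),
      S.dist k (Sum.elim (P.idealView .csp k g x) m)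
        = (unif (P.SimTape A.coins k)).map fun ω => A.run k (Sum.elim (P.cspView k (P.pk k g)
          (matBits _ x.Z₁) ω.2.2 (P.encVec k (P.pk k g) 0 ω.1) (idealF x)) m) ω.2.1 := by
  let α (k : ℕ) : Type := Bits (P.E.pkLen k) ×
    ((Fin (n k) × Fin (d k)) × Fin (P.E.msgLen k) → Bool) × (Fin (n k) → Bool) × Bits (inLen k)
  let inp (k : ℕ) (a : α k) : P.IdealIdx .csp k ⊕ Fin (inLen k) → Bool :=
    Sum.elim (Sum.elim a.1 (Sum.elim a.2.1 a.2.2.1)) a.2.2.2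
  suffices H : PolyComputable (α := fun k => α k × P.SimTape A.coins k)
      (fun k b => Sum.elim (inp k b.1) (P.simTapeEquiv A.coins k b.2))
      (fun k b => A.run k (Sum.elim (P.cspView k b.1.1 b.1.2.1 b.2.2.2
        (P.encVec k b.1.1 0 b.2.1) b.1.2.2.1) b.1.2.2.2) b.2.2.1) by
    obtain ⟨S, hS⟩ := exists_PPT inp (P.simTapeEquiv A.coins) (fun k a ω =>
      A.run k (Sum.elim (P.cspView k a.1 a.2.1 ω.2.2 (P.encVec k a.1 0 ω.1) a.2.2.1) a.2.2.2)
        ω.2.1) H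
    exact ⟨S, fun k g x m => hS k (P.pk k g, matBits _ x.Z₁, idealF x, m)⟩
  refine BitwisePoly.polyComputable ?_ ?_ A.poly.output_bounded
  · set inp' : ∀ k, α k × P.SimTape A.coins k →
        (P.IdealIdx .csp k ⊕ Fin (inLen k)) ⊕ P.SimTapeIdx A.coins k → Bool :=
      fun k b => Sum.elim (inp k b.1) (P.simTapeEquiv A.coins k b.2) with hinp'
    have hpk : BitwisePoly inp' fun k b => b.1.1 :=
      BitwisePoly.input (inp := inp') (κ := fun k => Fin (P.E.pkLen k))
        fun _ i => .inl (.inl (.inl i))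
    have hM : BitwisePoly inp' fun k b => b.1.2.1 :=
      BitwisePoly.input (inp := inp') (κ := fun k => (Fin (n k) × Fin (d k)) × Fin (P.E.msgLen k))
        fun _ i => .inl (.inl (.inr (.inl i)))
    have hI : BitwisePoly inp' fun k b => b.1.2.2.1 :=
      BitwisePoly.input (inp := inp') (κ := fun k => Fin (n k))
        fun _ i => .inl (.inl (.inr (.inr i)))
    have hm : BitwisePoly inp' fun k b => b.1.2.2.2 :=
      BitwisePoly.input (inp := inp') (κ := fun k => Fin (inLen k)) fun _ i => .inl (.inr i)
    have hr : BitwisePoly (κ := fun k => Fin (d k) × Fin (P.E.encCoins k)) inp'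
        fun k b p => b.2.1 p.1 p.2 :=
      BitwisePoly.input (inp := inp') (κ := fun k => Fin (d k) × Fin (P.E.encCoins k))
        fun _ i => .inr (.inl i)
    have ha : BitwisePoly inp' fun k b => b.2.2.1 :=
      BitwisePoly.input (inp := inp') (κ := fun k => Fin (A.coins k))
        fun _ i => .inr (.inr (.inl i))
    have hsd : BitwisePoly inp' fun k b => b.2.2.2.1 :=
      BitwisePoly.input (inp := inp') (κ := fun k => Fin (P.G.seedLen k))
        fun _ i => .inr (.inr (.inr (.inl i)))
    have he : BitwisePoly (κ := fun k => Fin (n k) × Fin (P.E.encCoins k)) inp'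
        fun k b p => b.2.2.2.2.1 p.1 p.2 :=
      BitwisePoly.input (inp := inp') (κ := fun k => Fin (n k) × Fin (P.E.encCoins k))
        fun _ i => .inr (.inr (.inr (.inr (.inl i))))
    have hgr : BitwisePoly inp' fun k b => b.2.2.2.2.2 :=
      BitwisePoly.input (inp := inp') (κ := fun k => Fin (P.Γ.coins k (P.circ k)))
        fun _ i => .inr (.inr (.inr (.inr (.inr i))))
    have h0 : BitwisePoly inp' fun k b =>
        resBits (P.E.msgLen k) (0 : Fin (d k) → ZMod (P.q k b.1.1)) := by
      convert BitwisePoly.const (inp := inp') (κ := fun k => Fin (d k) × Fin (P.E.msgLen k))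
        fun _ _ => false using 4 with k b
      simp [resBits]
    have hview := cspView_poly (P := P) (inp := inp') hpk hM hsd he hgr
      (P.encVec_poly (v := fun _ _ => 0) hpk h0 hr) hI
    exact BitwisePoly.apply_one A.poly
      (fun k (b : α k × P.SimTape A.coins k) => (Sum.elim (P.cspView k b.1.1 b.1.2.1 b.2.2.2
        (P.encVec k b.1.1 0 b.2.1) b.1.2.2.1) b.1.2.2.2, b.2.2.1))
      (.sumElim (.sumElim hview hm) ha)
  · simp only [Fintype.card_sum]
    refine PolyBounded.add (.add ?_ ?_) ?_
    · simp only [Fintype.card_prod, Fintype.card_fin]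
      exact P.pkLen_bounded.add (((hn.mul hd).mul P.msgLen_bounded).add hn)
    · simpa using A.inLen_bounded
    · simpa using P.simTapeIdx_bounded hn hd A.coins_bounded

variable (Z : P.Environment .csp inLen outLen)

/-- The coins that a reduction to the security of the encryption scheme hard-wires: of the
environment's choice, of CSP, of the adversary, and of the environment's answer. -/
abbrev InnerCoins (k : ℕ) : Type :=
  Bits (Z.coins k) × P.CSPTape k × Bits (A.coins k) × Bits (Z.answer.coins k)

/-- The environment's choice when CSP is corrupted. -/
abbrev cspChoice (k : ℕ) (pk : Bits (P.E.pkLen k)) (ω : InnerCoins A Z k) :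
    Inputs (n k) (d k) (P.q k pk) × Bits (inLen k) × Bits (Z.stLen k) :=
  Z.choose k pk Fin.elim0 ω.1

/-- The environment's answer if CSP is corrupted, as a function of the environment's state `st`, its
message `m`, the public key, the bits `M` of CSP's share, CSP's output `I`, and the ciphertexts `ct`
that CSP receives. -/
def cspAnswer (k : ℕ) (ω : InnerCoins A Z k) (st : Bits (Z.stLen k)) (m : Bits (inLen k))
    (pk : Bits (P.E.pkLen k)) (M : (Fin (n k) × Fin (d k)) × Fin (P.E.msgLen k) → Bool)
    (I : Fin (n k) → Bool) (ct : Fin (d k) → Bits (P.E.ctLen k)) : Bool :=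
  Z.answer.run k (Sum.elim st (Sum.elim (A.run k (Sum.elim (P.cspView k pk M ω.2.1 ct I) m)
    ω.2.2.1) I)) ω.2.2.2 ()

/-- The same with the values chosen by the environment. -/
def cspAnswerOf (k : ℕ) (ω : InnerCoins A Z k) (pk : Bits (P.E.pkLen k))
    (ct : Fin (d k) → Bits (P.E.ctLen k)) : Bool :=
  cspAnswer A Z k ω (cspChoice A Z k pk ω).2.2 (cspChoice A Z k pk ω).2.1 pk
    (matBits _ (cspChoice A Z k pk ω).1.Z₁) (idealF (cspChoice A Z k pk ω).1) ct

theorem cspAnswer_poly {α ι : ℕ → Type} {inp : ∀ k, α k → ι k → Bool}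
    (ω : ∀ k, InnerCoins A Z k) {st : ∀ k, α k → Bits (Z.stLen k)} {m : ∀ k, α k → Bits (inLen k)}
    {pk : ∀ k, α k → Bits (P.E.pkLen k)}
    {M : ∀ k, α k → (Fin (n k) × Fin (d k)) × Fin (P.E.msgLen k) → Bool}
    {I : ∀ k, α k → Fin (n k) → Bool} {ct : ∀ k, α k → Fin (d k) → Bits (P.E.ctLen k)}
    (hst : BitwisePoly inp st) (hm : BitwisePoly inp m) (hpk : BitwisePoly inp pk)
    (hM : BitwisePoly inp M) (hI : BitwisePoly inp I)
    (hct : BitwisePoly (κ := fun k => Fin (d k) × Fin (P.E.ctLen k)) inp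
      fun k a p => ct k a p.1 p.2) :
    BitwisePoly inp fun k a (_ : Unit) => cspAnswer A Z k (ω k) (st k a) (m k a) (pk k a) (M k a)
      (I k a) (ct k a) := by
  have hview := cspView_poly (P := P) (s := fun k _ => (ω k).2.1) hpk hM (.const _)
    (.const fun k (p : _ × _) => (ω k).2.1.2.1 p.1 p.2) (.const _) hct hI
  have hA := BitwisePoly.apply_one A.poly
    (fun k a => (Sum.elim (P.cspView k (pk k a) (M k a) (ω k).2.1 (ct k a) (I k a)) (m k a),
      (ω k).2.2.1)) (.sumElim (.sumElim hview hm) (.const _))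
  exact BitwisePoly.apply_one Z.answer.poly
    (fun k a => (Sum.elim (st k a) (Sum.elim (A.run k (Sum.elim
      (P.cspView k (pk k a) (M k a) (ω k).2.1 (ct k a) (I k a)) (m k a)) (ω k).2.2.1) (I k a)),
      (ω k).2.2.2))
    (.sumElim (.sumElim hst (.sumElim hA hI)) (.const _))

theorem toReal_real_csp (k : ℕ) :
    (P.real A Z k true).toReal = 𝔼 ω : InnerCoins A Z k, 𝔼 g, 𝔼 r,
      indic (cspAnswerOf A Z k ω (P.pk k g)
        (P.encVec k (P.pk k g) (cspChoice A Z k (P.pk k g) ω).1.w r)) := by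
  rw [Finset.expect_comm]
  refine (PMF.toReal_unif_bind _ _).trans (Finset.expect_congr rfl fun g _ => ?_)
  rw [expect_prod]
  refine (PMF.toReal_unif_bind _ _).trans (Finset.expect_congr rfl fun ρ _ => ?_)
  rw [Finset.expect_comm]
  refine (PMF.toReal_unif_bind _ _).trans (Finset.expect_congr rfl fun r _ => ?_)
  rw [expect_prod]
  refine (PMF.toReal_unif_bind _ _).trans (Finset.expect_congr rfl fun s _ => ?_)
  rw [expect_prod]
  refine (toReal_unif_map_bind _ _).trans (Finset.expect_congr rfl fun a _ => ?_)
  rw [PPT.toReal_bit, view_csp, exec_eq]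
  rfl

theorem toReal_ideal_csp (S : P.Simulator .csp inLen outLen) (hS : ∀ k
      (g : Bits (P.E.genCoins k)) (x : Inputs (n k) (d k) (P.q k (P.pk k g))) (m : Bits (inLen k)),
      S.dist k (Sum.elim (P.idealView .csp k g x) m)
        = (unif (P.SimTape A.coins k)).map fun ω => A.run k (Sum.elim (P.cspView k (P.pk k g)
          (matBits _ x.Z₁) ω.2.2 (P.encVec k (P.pk k g) 0 ω.1) (idealF x)) m) ω.2.1) (k : ℕ) :
    (P.ideal S Z k true).toReal = 𝔼 ω : InnerCoins A Z k, 𝔼 g, 𝔼 r,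
      indic (cspAnswerOf A Z k ω (P.pk k g) (P.encVec k (P.pk k g) 0 r)) := by
  rw [Finset.expect_comm]
  refine (PMF.toReal_unif_bind _ _).trans (Finset.expect_congr rfl fun g _ => ?_)
  rw [expect_prod]
  refine (PMF.toReal_unif_bind _ _).trans (Finset.expect_congr rfl fun ρ _ => ?_)
  dsimp only
  rw [hS]
  refine (toReal_unif_map_bind _ _).trans ?_
  rw [Finset.expect_comm, expect_prod]
  refine Finset.expect_congr rfl fun r _ => ?_
  rw [expect_prod, expect_prod, Finset.expect_comm]
  refine Finset.expect_congr rfl fun s _ => ?_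
  rw [expect_prod]
  refine Finset.expect_congr rfl fun a _ => ?_
  rw [PPT.toReal_bit]
  rfl

end CSP

end SecShGC

namespace SecShGC

variable {n d : ℕ → ℕ} {P : SecShGC n d} {inLen outLen : ℕ → ℕ}

/-! ### The chosen-plaintext attack and the hybrids for a corrupted CSP -/

section Attack

/-- The vector `w` with its first `j` entries replaced by zero. -/
def zeroBelow {m q : ℕ} (j : ℕ) (w : Fin m → ZMod q) : Fin m → ZMod q :=
  fun i => if (i : ℕ) < j then 0 else w i

theorem zeroBelow_zero {m q : ℕ} (w : Fin m → ZMod q) : zeroBelow 0 w = w := by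
  funext i
  simp [zeroBelow]

theorem zeroBelow_length {m q : ℕ} (w : Fin m → ZMod q) : zeroBelow m w = 0 := by
  funext i
  simp [zeroBelow]

/-- The entry number `j`, or zero if there is none. -/
def entryOrZero {m q : ℕ} (j : ℕ) (w : Fin m → ZMod q) : ZMod q :=
  if h : j < m then w ⟨j, h⟩ else 0

/-- The indicator vector of the inputs `x`, as computed by the sign-checking circuit without noise. -/
def plainIndicator (P : SecShGC n d) (k : ℕ) (pk : Bits (P.E.pkLen k))
    (x : Inputs (n k) (d k) (P.q k pk)) : Fin (n k) → Bool :=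
  fun i => !(P.circ k).eval (Sum.elim (cspBits (P.q k pk) (0 : Fin (n k) → ZMod (P.q k pk)))
    (resBits (P.E.msgLen k) ((x.Z₀ + x.Z₁).mulVec x.w))) i

theorem plainIndicator_eq (k : ℕ) (g : Bits (P.E.genCoins k))
    (x : Inputs (n k) (d k) (P.q k (P.pk k g))) :
    P.plainIndicator k (P.pk k g) x = idealF x := by
  funext i
  rw [plainIndicator, P.circ_eval]
  simp [idealF]

variable (A : P.Adversary .csp inLen outLen) (Z : P.Environment .csp inLen outLen)

/-- Index type of the bits that the chosen-plaintext attacker keeps: the environment's state and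
message, the public key, the bits of CSP's share, CSP's output, and all ciphertexts. -/
abbrev AttackIdx (k : ℕ) : Type :=
  Fin (Z.stLen k) ⊕ Fin (inLen k) ⊕ Fin (P.E.pkLen k) ⊕
    ((Fin (n k) × Fin (d k)) × Fin (P.E.msgLen k)) ⊕ Fin (n k) ⊕ (Fin (d k) × Fin (P.E.ctLen k))

/-- The bits that the attacker keeps, if it has hard-wired the coins `ω` and `r` and attacks the entry
number `j`. The ciphertexts are those of the `j`-th hybrid. -/
def attackState (k : ℕ) (ω : InnerCoins A Z k) (j : ℕ) (r : P.CloudTape k)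
    (pk : Bits (P.E.pkLen k)) : AttackIdx Z k → Bool :=
  Sum.elim (cspChoice A Z k pk ω).2.2 (Sum.elim (cspChoice A Z k pk ω).2.1 (Sum.elim pk
    (Sum.elim (matBits _ (cspChoice A Z k pk ω).1.Z₁)
      (Sum.elim (P.plainIndicator k pk (cspChoice A Z k pk ω).1)
        (fun p => P.encVec k pk (zeroBelow j (cspChoice A Z k pk ω).1.w) r p.1 p.2)))))

/-- The answer of the attacker with kept bits `b` on the challenge `c`: the environment's answer when
the ciphertext number `j` is replaced by `c`. -/
def attackAnswer (k : ℕ) (ω : InnerCoins A Z k) (j : ℕ) (b : AttackIdx Z k → Bool)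
    (c : Bits (P.E.ctLen k)) : Bool :=
  cspAnswer A Z k ω (fun i => b (.inl i)) (fun i => b (.inr (.inl i)))
    (fun i => b (.inr (.inr (.inl i)))) (fun i => b (.inr (.inr (.inr (.inl i)))))
    (fun i => b (.inr (.inr (.inr (.inr (.inl i))))))
    (fun i l => if (i : ℕ) = j then c l else b (.inr (.inr (.inr (.inr (.inr (i, l)))))))

/-- The attacker's choice, the entry number `j` against zero, and its state are efficient. -/
theorem attackChoice_poly (hn : PolyBounded n) (hd : PolyBounded d) (ω : ∀ k, InnerCoins A Z k)
    (j : ℕ → ℕ) (r : ∀ k, P.CloudTape k) :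
    PolyComputable (α := fun k => Bits (P.E.pkLen k) × Bits 0) (fun _ a => Sum.elim a.1 a.2)
      (fun k a => Sum.elim
        (Sum.elim
          (natBits (P.E.msgLen k) (entryOrZero (j k) (cspChoice A Z k a.1 (ω k)).1.w).val)
          (natBits (P.E.msgLen k) (0 : ZMod (P.q k a.1)).val))
        (fun i => attackState A Z k (ω k) (j k) (r k) a.1
          ((Fintype.equivFin (AttackIdx Z k)).symm i))) := by
  set inp : ∀ k, Bits (P.E.pkLen k) × Bits 0 → Fin (P.E.pkLen k) ⊕ Fin 0 → Bool :=
    fun _ a => Sum.elim a.1 a.2 with hinp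
  have hpk : BitwisePoly inp fun k a => a.1 :=
    BitwisePoly.input (inp := inp) (κ := fun k => Fin (P.E.pkLen k)) fun _ i => .inl i
  have hch := BitwisePoly.apply_one Z.choose_poly
    (fun k (a : Bits (P.E.pkLen k) × Bits 0) => (a.1, (Fin.elim0 : Bits 0), (ω k).1))
    (.sumElim hpk (.sumElim (.const _) (.const _)))
  have hZ₀ : BitwisePoly inp fun k a => matBits (P.E.msgLen k) (cspChoice A Z k a.1 (ω k)).1.Z₀ :=
    hch.reindex (μ := fun k => (Fin (n k) × Fin (d k)) × Fin (P.E.msgLen k))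
      fun _ i => .inl (.inl i)
  have hw : BitwisePoly inp fun k a => resBits (P.E.msgLen k) (cspChoice A Z k a.1 (ω k)).1.w :=
    hch.reindex (μ := fun k => Fin (d k) × Fin (P.E.msgLen k)) fun _ i => .inl (.inr (.inl i))
  have hZ₁ : BitwisePoly inp fun k a => matBits (P.E.msgLen k) (cspChoice A Z k a.1 (ω k)).1.Z₁ :=
    hch.reindex (μ := fun k => (Fin (n k) × Fin (d k)) × Fin (P.E.msgLen k))
      fun _ i => .inl (.inr (.inr i))
  have hm : BitwisePoly inp fun k a => (cspChoice A Z k a.1 (ω k)).2.1 :=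
    hch.reindex (μ := fun k => Fin (inLen k)) fun _ i => .inr (.inl i)
  have hst : BitwisePoly inp fun k a => (cspChoice A Z k a.1 (ω k)).2.2 :=
    hch.reindex (μ := fun k => Fin (Z.stLen k)) fun _ i => .inr (.inr i)
  have hq := BitwisePoly.apply_one P.E.modulus_poly
    (fun k (a : Bits (P.E.pkLen k) × Bits 0) => a.1) hpk
  have hprod := BitwisePoly.mulVec hd P.msgLen_bounded
    (fun k (a : Bits (P.E.pkLen k) × Bits 0) => P.q k a.1) _ _ _ hq hZ₀ hZ₁ hw
  have h0 : BitwisePoly inp fun k a =>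
      resBits (P.E.msgLen k) (0 : Fin (n k) → ZMod (P.q k a.1)) := by
    convert BitwisePoly.const (inp := inp) (κ := fun k => Fin (n k) × Fin (P.E.msgLen k))
      fun _ _ => false using 4 with k a
    simp [resBits]
  have hcirc : PolyComputable (α := fun k => SignIn (n k) (P.E.msgLen k) → Bool) (fun _ x => x)
      (fun k x => (P.circ k).eval x) := by
    obtain ⟨p, hp⟩ := P.circ_poly
    exact ⟨p, fun k => ⟨P.circ k, hp k, fun _ => rfl⟩⟩
  have hI : BitwisePoly inp fun k a => P.plainIndicator k a.1 (cspChoice A Z k a.1 (ω k)).1 :=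
    (BitwisePoly.apply_one hcirc (fun k (a : Bits (P.E.pkLen k) × Bits 0) =>
      Sum.elim (cspBits (P.q k a.1) (0 : Fin (n k) → ZMod (P.q k a.1)))
        (resBits (P.E.msgLen k) (((cspChoice A Z k a.1 (ω k)).1.Z₀ +
          (cspChoice A Z k a.1 (ω k)).1.Z₁).mulVec (cspChoice A Z k a.1 (ω k)).1.w)))
      (.sumElim (.sumElim hq h0) hprod)).not
  have hzero : BitwisePoly inp fun k a =>
      resBits (P.E.msgLen k) (zeroBelow (j k) (cspChoice A Z k a.1 (ω k)).1.w) := by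
    convert BitwisePoly.dite (p := fun k p => (p.1 : ℕ) < j k) (.const fun _ _ => false) hw
      using 4 with k a p
    unfold resBits zeroBelow
    split <;> simp
  have hct := P.encVec_poly (e := fun k _ => r k) hpk hzero
    (.const fun k (p : _ × _) => r k p.1 p.2)
  have hentry : BitwisePoly inp fun k a => natBits (P.E.msgLen k)
      (entryOrZero (j k) (cspChoice A Z k a.1 (ω k)).1.w).val := by
    obtain ⟨N, hN, hw⟩ := hw
    refine ⟨fun k => N k + 1, hN.add (.const 1), fun k i => ?_⟩
    by_cases h : j k < d k
    · simp only [entryOrZero, h, dif_pos]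
      exact (hw k (⟨j k, h⟩, i)).mono (Nat.le_succ _)
    · simp only [entryOrZero, h, dif_neg, not_false_eq_true, natBits, ZMod.val_zero,
        Nat.zero_testBit]
      exact .const false (Nat.le_add_left _ _)
  have hzero' : BitwisePoly inp fun k a =>
      natBits (P.E.msgLen k) (0 : ZMod (P.q k a.1)).val := by
    convert BitwisePoly.const (inp := inp) (κ := fun k => Fin (P.E.msgLen k))
      fun _ _ => false using 4 with k a
    simp [natBits]
  have hstate : BitwisePoly inp fun k a => attackState A Z k (ω k) (j k) (r k) a.1 :=
    .sumElim hst (.sumElim hm (.sumElim hpk (.sumElim hZ₁ (.sumElim hI hct))))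
  refine BitwisePoly.polyComputable (.sumElim (.sumElim hentry hzero')
    (hstate.reindex (μ := fun k => Fin (Fintype.card (AttackIdx Z k)))
      fun k i => (Fintype.equivFin (AttackIdx Z k)).symm i)) ?_ ?_
  · simpa using P.pkLen_bounded
  · have hstLen : PolyBounded Z.stLen := Z.choose_poly.output_bounded.mono fun k => by
      simp only [Fintype.card_sum, Fintype.card_fin]; omega
    simp only [Fintype.card_sum, Fintype.card_prod, Fintype.card_fin]
    exact (P.msgLen_bounded.add P.msgLen_bounded).add (hstLen.add (A.inLen_bounded.add
      (P.pkLen_bounded.add (((hn.mul hd).mul P.msgLen_bounded).add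
        (hn.add (hd.mul P.ctLen_bounded))))))

theorem exists_attacker (hn : PolyBounded n) (hd : PolyBounded d) (ω : ∀ k, InnerCoins A Z k)
    (j : ℕ → ℕ) (r : ∀ k, P.CloudTape k) :
    ∃ At : P.E.Attacker, ∀ k (b : Bool), (P.E.cpaGame At b k true).toReal =
      𝔼 g, 𝔼 r', indic (attackAnswer A Z k (ω k) (j k)
        (attackState A Z k (ω k) (j k) (r k) (P.pk k g))
        (P.E.enc k (P.pk k g) (if b then 0 else
          entryOrZero (j k) (cspChoice A Z k (P.pk k g) (ω k)).1.w) r')) := by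
  have hpoly := attackChoice_poly A Z hn hd ω j r
  have hlen : PolyBounded fun k => Fintype.card (AttackIdx Z k) :=
    hpoly.output_bounded.mono fun k => by simp only [Fintype.card_sum, Fintype.card_fin]; omega
  let v (k : ℕ) := Fintype.equivFin (AttackIdx Z k)
  set inp : ∀ k, Bits (Fintype.card (AttackIdx Z k)) × Bits (P.E.ctLen k) →
    Fin (Fintype.card (AttackIdx Z k)) ⊕ Fin (P.E.ctLen k) → Bool :=
    fun _ a => Sum.elim a.1 a.2 with hinp
  obtain ⟨D, hD⟩ := exists_distinguisher inp
    (fun k a => attackAnswer A Z k (ω k) (j k) (fun i => a.1 (v k i)) a.2) (by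
      refine cspAnswer_poly A Z ω ?_ ?_ ?_ ?_ ?_ ?_
      · exact BitwisePoly.input (inp := inp) (κ := fun k => Fin (Z.stLen k))
          fun k i => .inl (v k (.inl i))
      · exact BitwisePoly.input (inp := inp) (κ := fun k => Fin (inLen k))
          fun k i => .inl (v k (.inr (.inl i)))
      · exact BitwisePoly.input (inp := inp) (κ := fun k => Fin (P.E.pkLen k))
          fun k i => .inl (v k (.inr (.inr (.inl i))))
      · exact BitwisePoly.input (inp := inp)
          (κ := fun k => (Fin (n k) × Fin (d k)) × Fin (P.E.msgLen k))
          fun k i => .inl (v k (.inr (.inr (.inr (.inl i)))))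
      · exact BitwisePoly.input (inp := inp) (κ := fun k => Fin (n k))
          fun k i => .inl (v k (.inr (.inr (.inr (.inr (.inl i))))))
      · exact BitwisePoly.dite (inp := inp) (κ := fun k => Fin (d k) × Fin (P.E.ctLen k))
          (p := fun k p => (p.1 : ℕ) = j k)
          (BitwisePoly.input (inp := inp) fun k (p : _ × _) => .inr p.2)
          (BitwisePoly.input (inp := inp)
            fun k (p : _ × _) => .inl (v k (.inr (.inr (.inr (.inr (.inr (p.1, p.2)))))))))
    (by simpa using hlen.add P.ctLen_bounded)
  refine ⟨⟨fun _ => 0, fun k => Fintype.card (AttackIdx Z k), fun k pk _ =>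
    ((entryOrZero (j k) (cspChoice A Z k pk (ω k)).1.w, 0),
      fun i => attackState A Z k (ω k) (j k) (r k) pk ((v k).symm i)), hpoly, D⟩, fun k b => ?_⟩
  refine (PMF.toReal_unif_bind _ _).trans (Finset.expect_congr rfl fun g _ => ?_)
  refine (PMF.toReal_unif_bind _ _).trans ?_
  refine Eq.trans (Finset.expect_congr rfl fun _ _ => PMF.toReal_unif_bind _ _)
    ((Fintype.expect_const _).trans (Finset.expect_congr rfl fun r' _ => ?_))
  refine (hD k (fun i => attackState A Z k (ω k) (j k) (r k) (P.pk k g) ((v k).symm i),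
    _)).trans ?_
  simp only [Equiv.symm_apply_apply]

/-- Security of the encryption: a single ciphertext of a hybrid may be replaced by an encryption of
zero. -/
theorem csp_encryption_bound (hn : PolyBounded n) (hd : PolyBounded d) (hE : P.E.CPASecure) :
    ∃ ε : ℕ → ℝ, Negligible ε ∧ ∀ k (ω : InnerCoins A Z k) (j : Fin (d k)) (r : P.CloudTape k),
      |(𝔼 g, 𝔼 r', indic (cspAnswerOf A Z k ω (P.pk k g) (P.encVec k (P.pk k g)
          (zeroBelow j (cspChoice A Z k (P.pk k g) ω).1.w) (Function.update r j r'))))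
        - 𝔼 g, 𝔼 r', indic (cspAnswerOf A Z k ω (P.pk k g) (P.encVec k (P.pk k g)
          (zeroBelow (j + 1) (cspChoice A Z k (P.pk k g) ω).1.w) (Function.update r j r')))|
        ≤ ε k := by
  -- The index range is enlarged by one, so that it is never empty.
  obtain ⟨ε, hε, h⟩ := Negligible.exists_bound
    (Ω := fun k => InnerCoins A Z k × Fin (d k + 1) × P.CloudTape k)
    (fun k p => |(𝔼 g, 𝔼 r', indic (attackAnswer A Z k p.1 p.2.1
        (attackState A Z k p.1 p.2.1 p.2.2 (P.pk k g))
        (P.E.enc k (P.pk k g) (entryOrZero p.2.1 (cspChoice A Z k (P.pk k g) p.1).1.w) r')))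
      - 𝔼 g, 𝔼 r', indic (attackAnswer A Z k p.1 p.2.1
        (attackState A Z k p.1 p.2.1 p.2.2 (P.pk k g)) (P.E.enc k (P.pk k g) 0 r'))|) (by
      intro p
      obtain ⟨At, hAt⟩ := exists_attacker A Z hn hd (fun k => (p k).1) (fun k => (p k).2.1)
        (fun k => (p k).2.2)
      have := hE At
      simpa only [NegligibleGap, hAt, Bool.false_eq_true, if_false, if_true] using this)
  refine ⟨ε, hε, fun k ω j r => ?_⟩
  convert h k (ω, j.castSucc, r) using 2
  congr 1
  · refine Finset.expect_congr rfl fun g _ => Finset.expect_congr rfl fun r' _ => ?_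
    simp only [cspAnswerOf, attackAnswer, attackState, Sum.elim_inl, Sum.elim_inr,
      plainIndicator_eq]
    congr 2
    funext i l
    by_cases hi : i = j
    · subst hi
      simp [encVec, zeroBelow, entryOrZero]
    · simp [encVec, zeroBelow, hi, Fin.val_inj]
  · refine Finset.expect_congr rfl fun g _ => Finset.expect_congr rfl fun r' _ => ?_
    simp only [cspAnswerOf, attackAnswer, attackState, Sum.elim_inl, Sum.elim_inr,
      plainIndicator_eq]
    congr 2
    funext i l
    by_cases hi : i = j
    · subst hi
      simp [encVec, zeroBelow]
    · have hlt : (i : ℕ) < j + 1 ↔ (i : ℕ) < j := by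
        have : (i : ℕ) ≠ j := fun h => hi (Fin.ext h)
        omega
      simp [encVec, zeroBelow, hi, Fin.val_inj, hlt]

/-- The hybrid argument for a corrupted CSP, over the entries of the classifier. -/
theorem csp_secure (hn : PolyBounded n) (hd : PolyBounded d) (hE : P.E.CPASecure) :
    ∃ S : P.Simulator .csp inLen outLen, ∀ Z : P.Environment .csp inLen outLen,
      NegligibleGap (P.real A Z) (P.ideal S Z) := by
  obtain ⟨S, hS⟩ := exists_csp_simulator A hn hd
  refine ⟨S, fun Z => ?_⟩
  obtain ⟨ε, hε, h⟩ := csp_encryption_bound A Z hn hd hE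
  refine Negligible.of_abs_le (hε.mul_polyBounded hd) fun k => ?_
  rw [abs_abs, toReal_real_csp, toReal_ideal_csp A Z S hS]
  refine le_trans (abs_expect_sub_expect_le fun ω => ?_) (le_abs_self _)
  -- In the hybrid `j` the first `j` ciphertexts are encryptions of zero.
  let hyb (j : ℕ) : ℝ := 𝔼 r, 𝔼 g, indic (cspAnswerOf A Z k ω (P.pk k g)
    (P.encVec k (P.pk k g) (zeroBelow j (cspChoice A Z k (P.pk k g) ω).1.w) r))
  have hstep (j : ℕ) (hj : j < d k) : |hyb j - hyb (j + 1)| ≤ ε k := by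
    simp only [hyb]
    rw [expect_update (⟨j, hj⟩ : Fin (d k)), expect_update (⟨j, hj⟩ : Fin (d k)) fun r =>
      𝔼 g, indic (cspAnswerOf A Z k ω (P.pk k g)
        (P.encVec k (P.pk k g) (zeroBelow (j + 1) (cspChoice A Z k (P.pk k g) ω).1.w) r))]
    refine abs_expect_sub_expect_le fun r => ?_
    rw [Finset.expect_comm, Finset.expect_comm (f := fun r' g =>
      indic (cspAnswerOf A Z k ω (P.pk k g) (P.encVec k (P.pk k g)
        (zeroBelow (j + 1) (cspChoice A Z k (P.pk k g) ω).1.w)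
        (Function.update r (⟨j, hj⟩ : Fin (d k)) r'))))]
    exact h k ω ⟨j, hj⟩ r
  have hsum (j : ℕ) (hj : j ≤ d k) : |hyb 0 - hyb j| ≤ j * ε k := by
    induction j with
    | zero => simp
    | succ j ih =>
      refine (abs_sub_le _ (hyb j) _).trans
        ((add_le_add (ih (by omega)) (hstep j (by omega))).trans (le_of_eq ?_))
      push_cast
      ring
  convert hsum (d k) le_rfl using 3
  · rw [Finset.expect_comm]
    simp only [hyb, zeroBelow_zero]
  · rw [Finset.expect_comm]
    simp only [hyb, zeroBelow_length]

end Attack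

end SecShGC

theorem theorem2 (n d : ℕ → ℕ) (hn : PolyBounded n) (hd : PolyBounded d) (P : SecShGC n d)
    (hG : P.G.PseudoRandom) (hE : P.E.CPASecure) (hΓ : P.Γ.CPASecure) : P.UCRealizes := by
  intro c inLen outLen A
  cases c with
  | cloud => exact SecShGC.cloud_secure A hn hd hG hΓ
  | csp => exact SecShGC.csp_secure A hn hd hE
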